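/- **Setting.** Let $v_0\in[0,1]^d\setminus\{0,1\}^d$ and let $e_1,\dots,e_D$ be distinct vectors in $\mathbb Z^d+v_0$ with $\sum_i e_i=0$. Consider the bipartite graph with white vertices $\mathbb Z^d$, black vertices $\mathbb Z^d+v_0$ and an edge from $w$ to $w+e_i$ for every white $w$ and every $i$, and assume that it is connected. Let $\Lambda\subset\mathbb R^d$ be the image of this graph under an invertible linear map. A *region* is a finite set $S$ of vertices of $\Lambda$; $E(S)$ is the set of edges with both ends in $S$, $\partial S$ is the set of vertices of $S$ with a neighbour in $\Lambda\setminus S$, and $S^\circ=S\setminus\partial S$. An *$N$-dimer cover* of $S$ is a function $M:E(S)\to\{0,1,2,\dots\}$ whose vertex multiplicities $M_v:=\sum_{e\in E(S),\,e\ni v}M_e$ satisfy $M_v=N$ for $v\in S^\circ$ and $M_v\in\{1,\dots,N\}$ for $v\in\partial S$. The same definitions are used for $\frac1n\Lambda$. Let $R\subset\mathbb R^d$ be a compact domain (that is, $R$ is the closure of its interior) whose topological boundary $\partial R$ is piecewise smooth and connected, and fix $\delta>0$. Let $R_n\subset\frac1n\Lambda$ be regions such that, as $n\to\infty$, $R_n\to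 R$ and $\partial R_n\to\partial R$ in Hausdorff distance, and let $R_n^\delta\subset\frac1n\Lambda$ be regions that converge in Hausdorff distance to $\{x\in R: d(x,\partial R)>\delta\}$ (if this set is empty, $R_n^\delta$ is empty for large $n$). **Theorem (patching theorem).** Let $\mu_{n,N}$ and $\nu_{n,N}$ be probability measures on $N$-dimer covers of $R_n$. Suppose that for each $n$, as $N\to\infty$, the normalized boundary multiplicities $(M_v/N)_{v\in\partial R_n}$ of samples from $\mu_{n,N}$ and from $\nu_{n,N}$ converge in probability to constants $(\alpha^n_v)_{v\in\partial R_n}$ and $(\beta^n_v)_{v\in\partial R_n}$ respectively (for deterministic multiplicities this is ordinary convergence). Assume that * $\sup_{v\in\partial R_n}|\alpha^n_v-\beta^n_v|=O(1/n)$; * for each $n$, as $N\to\infty$, samples $M'$ from $\nu_{n,N}$ concentrate on a limiting flow $\omega_n:E(R_n)\to\mathbb R$ (edges oriented from white to black), that is, $\max_{e\in E(R_n)}|M'_e/N-\omega_n(e)|\to0$ in probability, where (i) $\sum_{e\ni v}\omega_n(e)=1$ for $v\in R_n^\circ$ and $\sum_{e\ni v}\omega_n(e)=\beta^n_v$ for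 $v\in\partial R_n$, and (ii) $\omega_n$ is strictly non-degenerate: there is $a>0$ independent of $n$ with $\omega_n(e)>a$ for all $e\in E(R_n)$. Let $(M,M')$ be a pair of samples, with any joint law (for example independent), where $M$ has law $\mu_{n,N}$ and $M'$ has law $\nu_{n,N}$. Let $p_{n,N}$ be the probability that there exists an $N$-dimer cover $M''$ of $R_n$ such that $M''_e=M'_e$ for all edges $e\in E(R_n)$ with an endpoint in $(R_n^\delta)^\circ$, and $M''_v=M_v$ for all $v\in\partial R_n$. Then $p_{n,N}\to1$ in the iterated limit as $N\to\infty$ and then $n\to\infty$: for all large $n$ the limit $p_n=\lim_{N\to\infty}p_{n,N}$ exists, and $p_n\to1$ as $n\to\infty$. (It is enough that each hypothesis imposed for each $n$ holds for all large $n$, and that the measures are supported on $N$-dimer covers for all large $N$ given $n$.) -/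

import Mathlib

open MeasureTheory Filter Topology

noncomputable section

/-- Vertices of a lattice with white vertices `ℤ^d` and black vertices `ℤ^d + v₀`:
`Sum.inl w` is the white vertex `w`, and `Sum.inr b` is the black vertex `b + v₀`. -/
abbrev LVertex (d : ℕ) : Type := (Fin d → ℤ) ⊕ (Fin d → ℤ)

/-- Edges of a lattice of degree `D`: the pair `(w, i)` is the edge of type `e_i` at the white
vertex `w`. Edges are thus oriented from white to black. -/
abbrev LEdge (d D : ℕ) : Type := (Fin d → ℤ) × Fin D

/-- The bipartite graph in which the white vertex `w` is joined to the black vertices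
`w + e_i = (w + shift i) + v₀`, where `e_i = shift i + v₀`. -/
def latticeGraph {d D : ℕ} (shift : Fin D → Fin d → ℤ) : SimpleGraph (LVertex d) :=
  SimpleGraph.fromRel fun u v => ∃ w i, u = Sum.inl w ∧ v = Sum.inr (w + shift i)

/-- A connected, harmonically embedded, `D`-regular bipartite lattice in `ℝ^d`: the image under
an invertible linear map of the graph with white vertices `ℤ^d`, black vertices `ℤ^d + v₀`, and
edges from `w` to `w + e_1, …, w + e_D`, where `e_i = shift i + v₀`. -/
structure DimerLattice (d D : ℕ) where
  v₀ : Fin d → ℝ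
  v₀_mem : ∀ j, v₀ j ∈ Set.Icc (0 : ℝ) 1
  v₀_not_vertex : ∃ j, v₀ j ≠ 0 ∧ v₀ j ≠ 1
  shift : Fin D → Fin d → ℤ
  shift_injective : Function.Injective shift
  harmonic : ∀ j, ∑ i, ((shift i j : ℝ) + v₀ j) = 0
  connected : (latticeGraph shift).Connected
  toSpace : (Fin d → ℝ) ≃ₗ[ℝ] EuclideanSpace ℝ (Fin d)

namespace DimerLattice

variable {d D : ℕ} (Λ : DimerLattice d D)

/-- Position in `ℝ^d` of a vertex of `Λ`. -/
def pos : LVertex d → EuclideanSpace ℝ (Fin d)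
  | Sum.inl w => Λ.toSpace fun j => (w j : ℝ)
  | Sum.inr b => Λ.toSpace fun j => (b j : ℝ) + Λ.v₀ j

/-- The subset of `ℝ^d` formed by the vertices in `S`, in the rescaled lattice `(1/n) Λ`. -/
def scaledPoints (n : ℕ) (S : Set (LVertex d)) : Set (EuclideanSpace ℝ (Fin d)) :=
  (fun v => (n : ℝ)⁻¹ • Λ.pos v) '' S

/-- The vertex sets `S n`, placed in `(1/n) Λ`, converge to `X` in Hausdorff distance. -/
def HausdorffApprox (S : ℕ → Set (LVertex d)) (X : Set (EuclideanSpace ℝ (Fin d))) : Prop :=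
  Tendsto (fun n => Metric.hausdorffEDist (Λ.scaledPoints n (S n)) X) atTop (𝓝 0)

/-- The white end of an edge. -/
def whiteEnd (e : LEdge d D) : LVertex d := Sum.inl e.1

/-- The black end of an edge. -/
def blackEnd (e : LEdge d D) : LVertex d := Sum.inr (e.1 + Λ.shift e.2)

/-- The boundary in `Λ` of a region: its vertices with a neighbour outside the region. -/
def boundary (S : Finset (LVertex d)) : Set (LVertex d) :=
  {v | v ∈ S ∧ ∃ u, u ∉ S ∧ (latticeGraph Λ.shift).Adj v u}

/-- The interior of a region. -/
def interior (S : Finset (LVertex d)) : Set (LVertex d) :=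
  {v | v ∈ S ∧ v ∉ Λ.boundary S}

/-- The edges of a region: the edges of `Λ` with both ends in the region. -/
def edges (S : Finset (LVertex d)) : Set (LEdge d D) :=
  {e | whiteEnd e ∈ S ∧ Λ.blackEnd e ∈ S}

/-- The sum of `f` over the edges of the region `S` that are incident to the vertex `v`. -/
def vertexSum {A : Type*} [AddCommMonoid A] (S : Finset (LVertex d)) (f : LEdge d D → A) :
    LVertex d → A
  | Sum.inl w => ∑ i, (Λ.edges S).indicator f (w, i)
  | Sum.inr b => ∑ i, (Λ.edges S).indicator f (b - Λ.shift i, i)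

/-- `M` is a dimer cover of the region `S` with multiplicity `N` at all interior vertices and
some multiplicity in `{1, …, N}` at each boundary vertex. (A function on the edges of `S` is
encoded as a function on all edges of `Λ` that vanishes off the edges of `S`.) -/
structure IsDimerCover (S : Finset (LVertex d)) (N : ℕ) (M : LEdge d D → ℕ) : Prop where
  eq_zero_off : ∀ e, e ∉ Λ.edges S → M e = 0
  interior_eq : ∀ v ∈ Λ.interior S, Λ.vertexSum S M v = N
  boundary_mem : ∀ v ∈ Λ.boundary S, Λ.vertexSum S M v ∈ Set.Icc 1 N

/-- As `N → ∞`, the boundary vertex multiplicities of samples from `μ N`, divided by `N`,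
converge in probability to `α`. -/
def BoundaryMultiplicitiesTendTo (S : Finset (LVertex d))
    (μ : ℕ → Measure (LEdge d D → ℕ)) (α : LVertex d → ℝ) : Prop :=
  ∀ ε : ℝ, 0 < ε → Tendsto
    (fun N => μ N {M | ∃ v ∈ Λ.boundary S, ε ≤ |((Λ.vertexSum S M v : ℕ) : ℝ) / N - α v|})
    atTop (𝓝 0)

/-- As `N → ∞`, samples from `ν N`, divided by `N`, concentrate on `ω`: they converge to it in
probability, uniformly over the edges of the region. -/
def ConcentratesOn (S : Finset (LVertex d))
    (ν : ℕ → Measure (LEdge d D → ℕ)) (ω : LEdge d D → ℝ) : Prop :=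
  ∀ ε : ℝ, 0 < ε → Tendsto
    (fun N => ν N {M | ∃ e ∈ Λ.edges S, ε ≤ |(M e : ℝ) / N - ω e|}) atTop (𝓝 0)

/-- There is a dimer cover `M''` of `S` which agrees with `M'` on all edges of `S` that have an
end in the interior of `T`, and has the vertex multiplicities of `M` on the boundary of `S`. -/
def Patchable (S T : Finset (LVertex d)) (N : ℕ) (M M' : LEdge d D → ℕ) : Prop :=
  ∃ M'' : LEdge d D → ℕ, Λ.IsDimerCover S N M'' ∧
    (∀ e ∈ Λ.edges S, whiteEnd e ∈ Λ.interior T ∨ Λ.blackEnd e ∈ Λ.interior T →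
      M'' e = M' e) ∧
    ∀ v ∈ Λ.boundary S, Λ.vertexSum S M'' v = Λ.vertexSum S M v

end DimerLattice

/-- The topological boundary of `R` is a finite union of `C^1` (in particular, smooth) images of
the closed cube `[0,1]^(d-1)`. -/
def HasPiecewiseSmoothBoundary {d : ℕ} (R : Set (EuclideanSpace ℝ (Fin d))) : Prop :=
  ∃ (k : ℕ) (φ : Fin k → (Fin (d - 1) → ℝ) → EuclideanSpace ℝ (Fin d)),
    (∀ i, ContDiffOn ℝ 1 (φ i) (Set.Icc 0 1)) ∧ frontier R = ⋃ i, φ i '' Set.Icc 0 1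

end

/-! Probability enters only at the end. For fixed large n, outside an event whose probability tends
to 0 as N → ∞, both samples are covers, their boundary multiplicities differ by O(N/n), and M' is at
least a fixed positive multiple of N on every edge. For all such pairs patching is possible
deterministically (`eventually_patchable`).

Keep M' on the frozen edges, those touching the interior of `T`. What remains is a
prescribed-multiplicity problem on the free edges. By Hall's theorem it is solvable if, for every
vertex set U, the signed boundary discrepancy of M and M' on U is at most the cost of the free edges
cut by U (`patchable_of_cuts`). An edge with only its black end in U costs M'_e. Hall's condition
never sees an edge with only its white end in U; giving it the finite cost 2N - M'_e allows
arbitrary U and keeps the cost of every cut edge between a fixed multiple of N and 2N. If U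
separates the ends of no frozen edge, its inequality holds because M itself has the required
multiplicities (`signedDiff_le_of_not_cut_frozen`).

Now let U maximize discrepancy minus cost. Comparison with the empty set bounds the cost by the
discrepancy, which is O(N/n) times the number of boundary vertices. That number is o(n^d) because
the frontier of R is null, so U cuts only o(n^(d-1)) edges in a collar inside R. Maximality also
makes U quasi-minimal: emptying or filling a cube cannot improve it. As in the regularity theory of
minimal surfaces, an isoperimetric inequality and a De Giorgi iteration show that such a set, with
small cut in a cube of size comparable to n, is trivial in a concentric smaller cube of comparable
size (`exists_clearing`). Hence U is locally constant in the collar on the macroscopic scale.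

Since the frontier is connected and ℝ^d is simply connected, this locally constant function extends
through the inner part of R (`exists_extension_of_locally_constant`). Replacing U by the extension
deep inside keeps the discrepancy, does not raise the cost, and separates no frozen edge. So the
maximal value of discrepancy minus cost is at most 0, and every cut inequality holds. -/

/-! ### Hall's theorem with multiplicities -/

/-- Hall's theorem with multiplicities: a bipartite graph with prescribed vertex multiplicities
has an edge weighting with these multiplicities when every set of sources fits into its
neighbourhood. -/
theorem exists_edge_weights_of_hall {X Y ε : Type*} [DecidableEq X] [DecidableEq Y]
    [DecidableEq ε] (E : Finset ε) (s : ε → X) (t : ε → Y) (A : Finset X) (B : Finset Y)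
    (ht : ∀ e ∈ E, t e ∈ B) (p : X → ℕ) (q : Y → ℕ)
    (htotal : ∑ x ∈ A, p x = ∑ y ∈ B, q y)
    (hall : ∀ A' ⊆ A, ∑ x ∈ A', p x ≤ ∑ y ∈ (E.filter fun e => s e ∈ A').image t, q y) :
    ∃ f : ε → ℕ, (∀ e, f e ≠ 0 → e ∈ E ∧ s e ∈ A) ∧
      (∀ x ∈ A, ∑ e ∈ E.filter (fun e => s e = x), f e = p x) ∧
      ∀ y ∈ B, ∑ e ∈ E.filter (fun e => t e = y), f e = q y := by
  classical
  -- Each vertex is replaced by as many copies as its multiplicity, and the ordinary Hall theorem is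
  -- applied to the copies. Equality of the totals makes the resulting injection a bijection; the
  -- weight of an edge is the number of copies matched along it.
  let I := Σ x : A, Fin (p x)
  let J := Σ y : B, Fin (q y)
  have hIc : Fintype.card I = ∑ x ∈ A, p x := by
    simp only [I, Fintype.card_sigma, Fintype.card_fin]
    exact Finset.sum_coe_sort A p
  have hJc : Fintype.card J = ∑ y ∈ B, q y := by
    simp only [J, Fintype.card_sigma, Fintype.card_fin]
    exact Finset.sum_coe_sort B q
  let nb : I → Finset J := fun i => Finset.univ.filter fun j => ∃ e ∈ E, s e = i.1 ∧ t e = j.1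
  have hallI : ∀ Z : Finset I, Z.card ≤ (Z.biUnion nb).card := by
    intro Z
    let A' : Finset X := Z.image fun i => (i.1 : X)
    have hA' : A' ⊆ A := by
      intro x hx
      obtain ⟨i, -, rfl⟩ := Finset.mem_image.1 hx
      exact i.1.2
    have h1 : Z.card ≤ ∑ x ∈ A', p x := by
      have : Z ⊆ (A'.subtype (· ∈ A)).sigma fun x => (Finset.univ : Finset (Fin (p x))) := by
        intro i hi
        exact Finset.mem_sigma.2 ⟨Finset.mem_subtype.2
          (Finset.mem_image_of_mem (fun i : I => (i.1 : X)) hi), Finset.mem_univ _⟩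
      refine (Finset.card_le_card this).trans ?_
      rw [Finset.card_sigma]
      simp only [Finset.card_univ, Fintype.card_fin]
      rw [Finset.sum_subtype_of_mem (p := (· ∈ A)) p fun x hx => hA' hx]
    have h2 : ∑ y ∈ (E.filter fun e => s e ∈ A').image t, q y ≤ (Z.biUnion nb).card := by
      set B' := (E.filter fun e => s e ∈ A').image t with hB'
      have hB'B : B' ⊆ B := by
        intro y hy
        obtain ⟨e, he, rfl⟩ := Finset.mem_image.1 hy
        exact ht e (Finset.mem_filter.1 he).1
      have : ((B'.subtype (· ∈ B)).sigma fun y => (Finset.univ : Finset (Fin (q y)))) ⊆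
          Z.biUnion nb := by
        rintro ⟨y, k⟩ hj
        simp only [Finset.mem_sigma, Finset.mem_subtype, Finset.mem_univ, and_true] at hj
        obtain ⟨e, he, hey⟩ := Finset.mem_image.1 hj
        obtain ⟨heE, hes⟩ := Finset.mem_filter.1 he
        obtain ⟨i, hi, hie⟩ := Finset.mem_image.1 hes
        exact Finset.mem_biUnion.2 ⟨i, hi, Finset.mem_filter.2
          ⟨Finset.mem_univ _, e, heE, hie.symm, hey⟩⟩
      refine le_trans (le_of_eq ?_) (Finset.card_le_card this)
      rw [Finset.card_sigma]
      simp only [Finset.card_univ, Fintype.card_fin]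
      rw [Finset.sum_subtype_of_mem (p := (· ∈ B)) q fun x hx => hB'B hx]
    exact h1.trans ((hall A' hA').trans h2)
  obtain ⟨φ, hφi, hφ⟩ := (Finset.all_card_le_biUnion_card_iff_exists_injective nb).1 hallI
  have hφb : Function.Bijective φ :=
    (Fintype.bijective_iff_injective_and_card φ).2 ⟨hφi, by rw [hIc, hJc, htotal]⟩
  have hφ' : ∀ i, ∃ e ∈ E, s e = i.1 ∧ t e = (φ i).1 := fun i => (Finset.mem_filter.1 (hφ i)).2
  choose ed hedE heds hedt using hφ'
  refine ⟨fun e => (Finset.univ.filter fun i => ed i = e).card, ?_, ?_, ?_⟩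
  · intro e he
    obtain ⟨i, hi⟩ := Finset.card_ne_zero.1 he
    obtain rfl := (Finset.mem_filter.1 hi).2
    exact ⟨hedE i, by rw [heds]; exact i.1.2⟩
  · intro x hx
    have h1 : (Finset.univ.filter fun i : I => (i.1 : X) = x).card = p x := by
      have : (Finset.univ.filter fun i : I => (i.1 : X) = x) =
          (Finset.univ : Finset (Fin (p x))).map
            ⟨fun k => (⟨⟨x, hx⟩, k⟩ : I), fun a b h => by simpa using h⟩ := by
        ext ⟨⟨x', hx'⟩, k⟩
        simp only [Finset.mem_filter, Finset.mem_univ, true_and, Finset.mem_map]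
        constructor
        · rintro rfl
          exact ⟨k, rfl⟩
        · rintro ⟨k', h⟩
          have := congrArg (fun i : I => (i.1 : X)) h
          exact this.symm
      rw [this, Finset.card_map, Finset.card_univ, Fintype.card_fin]
    rw [← h1, Finset.card_eq_sum_card_fiberwise (f := ed)
      (t := E.filter fun e => s e = x)]
    · refine Finset.sum_congr rfl fun e he => ?_
      refine congrArg Finset.card (Finset.ext fun i => ?_)
      simp only [Finset.mem_filter, Finset.mem_univ, true_and]
      constructor
      · rintro rfl
        exact ⟨by rw [← heds]; exact (Finset.mem_filter.1 he).2, rfl⟩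
      · exact fun h => h.2
    · intro i hi
      have hi' := (Finset.mem_filter.1 hi).2
      exact Finset.mem_coe.2 (Finset.mem_filter.2 ⟨hedE i, by rw [heds, hi']⟩)
  · intro y hy
    have h1 : (Finset.univ.filter fun j : J => (j.1 : Y) = y).card = q y := by
      have : (Finset.univ.filter fun j : J => (j.1 : Y) = y) =
          (Finset.univ : Finset (Fin (q y))).map
            ⟨fun k => (⟨⟨y, hy⟩, k⟩ : J), fun a b h => by simpa using h⟩ := by
        ext ⟨⟨x', hx'⟩, k⟩
        simp only [Finset.mem_filter, Finset.mem_univ, true_and, Finset.mem_map]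
        constructor
        · rintro rfl
          exact ⟨k, rfl⟩
        · rintro ⟨k', h⟩
          have := congrArg (fun i : J => (i.1 : Y)) h
          exact this.symm
      rw [this, Finset.card_map, Finset.card_univ, Fintype.card_fin]
    have h2 : (Finset.univ.filter fun i : I => ((φ i).1 : Y) = y).card = q y := by
      rw [← h1]
      refine Finset.card_bij (fun i _ => φ i) ?_ (fun a _ b _ h => hφi h) ?_
      · intro i hi
        simpa using hi
      · intro j hj
        obtain ⟨i, rfl⟩ := hφb.2 j
        exact ⟨i, by simpa using hj, rfl⟩
    rw [← h2, Finset.card_eq_sum_card_fiberwise (f := ed)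
      (t := E.filter fun e => t e = y)]
    · refine Finset.sum_congr rfl fun e he => ?_
      refine congrArg Finset.card (Finset.ext fun i => ?_)
      simp only [Finset.mem_filter, Finset.mem_univ, true_and]
      constructor
      · rintro rfl
        exact ⟨by rw [← hedt]; exact (Finset.mem_filter.1 he).2, rfl⟩
      · exact fun h => h.2
    · intro i hi
      have hi' := (Finset.mem_filter.1 hi).2
      exact Finset.mem_coe.2 (Finset.mem_filter.2 ⟨hedE i, by rw [hedt, hi']⟩)

/-! ### The cut criterion for patchability -/

namespace DimerLattice

variable {d D : ℕ} (Λ : DimerLattice d D)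

/-- The finite set of edges of a region. -/
noncomputable def edgeFinset (S : Finset (LVertex d)) : Finset (LEdge d D) :=
  (S.toLeft ×ˢ Finset.univ).filter fun e => Λ.blackEnd e ∈ S

theorem mem_edgeFinset {S : Finset (LVertex d)} {e : LEdge d D} :
    e ∈ Λ.edgeFinset S ↔ e ∈ Λ.edges S := by
  simp [edgeFinset, edges, whiteEnd]

/-- The sum of `f` over the edges in `G` incident to `v`. -/
noncomputable def incidentSum {A : Type*} [AddCommMonoid A] (G : Finset (LEdge d D)) (f : LEdge d D → A)
    (v : LVertex d) : A :=
  ∑ e ∈ G.filter (fun e => whiteEnd e = v ∨ Λ.blackEnd e = v), f e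

theorem vertexSum_eq_incidentSum {A : Type*} [AddCommMonoid A] (S : Finset (LVertex d))
    (f : LEdge d D → A) (v : LVertex d) :
    Λ.vertexSum S f v = Λ.incidentSum (Λ.edgeFinset S) f v := by
  classical
  unfold incidentSum
  rcases v with w | b
  · have h : (Λ.edgeFinset S).filter (fun e => whiteEnd e = Sum.inl w ∨ Λ.blackEnd e = Sum.inl w) =
        ((Finset.univ : Finset (Fin D)).filter fun i => (w, i) ∈ Λ.edges S).map
          ⟨fun i => (w, i), fun i j h => by simpa using h⟩ := by
      ext ⟨w', i⟩
      simp only [Finset.mem_filter, mem_edgeFinset, whiteEnd, blackEnd, Finset.mem_map,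
        Finset.mem_univ, true_and, Sum.inl.injEq, reduceCtorEq, or_false]
      constructor
      · rintro ⟨h, rfl⟩
        exact ⟨i, h, rfl⟩
      · rintro ⟨j, h, hj⟩
        obtain ⟨rfl, rfl⟩ := Prod.mk.inj hj
        exact ⟨h, rfl⟩
    rw [h, Finset.sum_map, Finset.sum_filter]
    exact Finset.sum_congr rfl fun i _ => by
      simp only [Set.indicator_apply]
      rfl
  · have h : (Λ.edgeFinset S).filter (fun e => whiteEnd e = Sum.inr b ∨ Λ.blackEnd e = Sum.inr b) =
        ((Finset.univ : Finset (Fin D)).filter fun i => (b - Λ.shift i, i) ∈ Λ.edges S).map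
          ⟨fun i => (b - Λ.shift i, i), fun i j h => (Prod.mk.inj h).2⟩ := by
      ext ⟨w', i⟩
      simp only [Finset.mem_filter, mem_edgeFinset, whiteEnd, blackEnd, Finset.mem_map,
        Finset.mem_univ, true_and, Sum.inr.injEq, reduceCtorEq, false_or]
      constructor
      · rintro ⟨h, rfl⟩
        exact ⟨i, by simpa using h, Prod.ext (add_sub_cancel_right _ _) rfl⟩
      · rintro ⟨j, h, hj⟩
        obtain ⟨rfl, rfl⟩ := Prod.mk.inj hj
        exact ⟨h, by simp⟩
    rw [h, Finset.sum_map, Finset.sum_filter]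
    exact Finset.sum_congr rfl fun i _ => by
      simp only [Set.indicator_apply]
      rfl

theorem incidentSum_whiteEnd {A : Type*} [AddCommMonoid A] (G : Finset (LEdge d D))
    (f : LEdge d D → A) {v : LVertex d} (hv : v.isLeft) :
    Λ.incidentSum G f v = ∑ e ∈ G.filter (fun e => whiteEnd e = v), f e := by
  rcases v with w | b
  · simp [incidentSum, blackEnd]
  · simp at hv

theorem incidentSum_blackEnd {A : Type*} [AddCommMonoid A] (G : Finset (LEdge d D))
    (f : LEdge d D → A) {v : LVertex d} (hv : v.isRight) :
    Λ.incidentSum G f v = ∑ e ∈ G.filter (fun e => Λ.blackEnd e = v), f e := by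
  rcases v with w | b
  · simp at hv
  · simp [incidentSum, whiteEnd]

/-- The sign `1` of white and `-1` of black vertices. -/
def sign : LVertex d → ℤ := Sum.elim (fun _ => 1) fun _ => -1

/-- A discrete divergence theorem: the two ends of an edge have opposite signs, so edges inside U
cancel and only cut edges contribute. -/
theorem sum_sign_mul_incidentSum (G : Finset (LEdge d D)) (f : LEdge d D → ℤ)
    (U : Finset (LVertex d)) :
    ∑ v ∈ U, sign v * Λ.incidentSum G f v =
      ∑ e ∈ G, f e * ((if whiteEnd e ∈ U then 1 else 0) - if Λ.blackEnd e ∈ U then 1 else 0) := by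
  classical
  simp only [incidentSum, Finset.sum_filter, Finset.mul_sum]
  rw [Finset.sum_comm]
  refine Finset.sum_congr rfl fun e _ => ?_
  have h : ∀ v : LVertex d, sign v * (if whiteEnd e = v ∨ Λ.blackEnd e = v then f e else 0) =
      (if whiteEnd e = v then f e else 0) - if Λ.blackEnd e = v then f e else 0 := by
    rintro (w | b)
    · simp [sign, whiteEnd, blackEnd]
    · have hw : whiteEnd e ≠ Sum.inr b := Sum.inl_ne_inr
      by_cases h : Λ.blackEnd e = Sum.inr b <;> simp [sign, hw, h]
  simp only [h, Finset.sum_sub_distrib, Finset.sum_ite_eq]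
  split_ifs <;> simp

theorem incidentSum_natCast (G : Finset (LEdge d D)) (f : LEdge d D → ℕ) (v : LVertex d) :
    ((Λ.incidentSum G f v : ℕ) : ℤ) = Λ.incidentSum G (fun e => (f e : ℤ)) v := by
  simp [incidentSum]

/-- The cost of an edge that is cut by `U`. -/
noncomputable def cutCost (N : ℕ) (M' : LEdge d D → ℕ) (U : Finset (LVertex d)) (e : LEdge d D) : ℤ :=
  if Λ.blackEnd e ∈ U ∧ whiteEnd e ∉ U then (M' e : ℤ)
  else if whiteEnd e ∈ U ∧ Λ.blackEnd e ∉ U then 2 * N - M' e else 0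

/-- The signed difference on `U` of the vertex multiplicities of two covers. -/
noncomputable def signedDiff (S : Finset (LVertex d)) (M M' : LEdge d D → ℕ) (U : Finset (LVertex d)) : ℤ :=
  ∑ v ∈ U, sign v * (((Λ.vertexSum S M v : ℕ) : ℤ) - (Λ.vertexSum S M' v : ℕ))

open Classical in
/-- The edges of `S` with an end in the interior of `T`. -/
noncomputable def frozen (S T : Finset (LVertex d)) : Finset (LEdge d D) :=
  (Λ.edgeFinset S).filter fun e => whiteEnd e ∈ Λ.interior T ∨ Λ.blackEnd e ∈ Λ.interior T

open Classical in
/-- The edges of `S` without an end in the interior of `T`. -/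
noncomputable def free (S T : Finset (LVertex d)) : Finset (LEdge d D) :=
  (Λ.edgeFinset S).filter fun e => ¬ (whiteEnd e ∈ Λ.interior T ∨ Λ.blackEnd e ∈ Λ.interior T)

theorem incidentSum_frozen_add_free {A : Type*} [AddCommMonoid A] (S T : Finset (LVertex d))
    (f : LEdge d D → A) (v : LVertex d) :
    Λ.incidentSum (Λ.frozen S T) f v + Λ.incidentSum (Λ.free S T) f v = Λ.vertexSum S f v := by
  classical
  rw [vertexSum_eq_incidentSum]
  simp only [incidentSum, Finset.sum_filter, frozen, free]
  rw [← Finset.sum_add_distrib]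
  refine Finset.sum_congr rfl fun e _ => ?_
  split_ifs <;> simp

theorem mem_interior_or_boundary {S : Finset (LVertex d)} {v : LVertex d} (hv : v ∈ S) :
    v ∈ Λ.interior S ∨ v ∈ Λ.boundary S := by
  by_cases h : v ∈ Λ.boundary S
  · exact Or.inr h
  · exact Or.inl ⟨hv, h⟩

variable {Λ}

theorem IsDimerCover.vertexSum_le {S : Finset (LVertex d)} {N : ℕ} {M : LEdge d D → ℕ}
    (hM : Λ.IsDimerCover S N M) {v : LVertex d} (hv : v ∈ S) : Λ.vertexSum S M v ≤ N := by
  rcases Λ.mem_interior_or_boundary hv with h | h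
  · exact (hM.interior_eq v h).le
  · exact (hM.boundary_mem v h).2

theorem IsDimerCover.le {S : Finset (LVertex d)} {N : ℕ} {M : LEdge d D → ℕ}
    (hM : Λ.IsDimerCover S N M) (e : LEdge d D) : M e ≤ N := by
  by_cases he : e ∈ Λ.edges S
  · refine le_trans ?_ (hM.vertexSum_le he.1)
    rw [vertexSum_eq_incidentSum]
    exact Finset.single_le_sum (f := M) (fun _ _ => Nat.zero_le _)
      (Finset.mem_filter.2 ⟨Λ.mem_edgeFinset.2 he, Or.inl rfl⟩)
  · rw [hM.eq_zero_off e he]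
    exact Nat.zero_le _

/-- A cut that does not separate the ends of frozen edges is not violated. -/
theorem signedDiff_le_of_not_cut_frozen {S T : Finset (LVertex d)} {N : ℕ} {M M' : LEdge d D → ℕ}
    (hM : Λ.IsDimerCover S N M) (U : Finset (LVertex d))
    (hU : ∀ e ∈ Λ.frozen S T, whiteEnd e ∈ U ↔ Λ.blackEnd e ∈ U) :
    Λ.signedDiff S M M' U ≤ ∑ e ∈ Λ.free S T, Λ.cutCost N M' U e := by
  classical
  have h1 : Λ.signedDiff S M M' U = ∑ e ∈ Λ.edgeFinset S, ((M e : ℤ) - M' e) *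
      ((if whiteEnd e ∈ U then 1 else 0) - if Λ.blackEnd e ∈ U then 1 else 0) := by
    rw [← sum_sign_mul_incidentSum]
    refine Finset.sum_congr rfl fun v _ => ?_
    rw [vertexSum_eq_incidentSum, vertexSum_eq_incidentSum, incidentSum_natCast,
      incidentSum_natCast]
    simp only [incidentSum, Finset.sum_sub_distrib]
  rw [h1, ← Finset.sum_filter_add_sum_filter_not (Λ.edgeFinset S)
    (fun e => whiteEnd e ∈ Λ.interior T ∨ Λ.blackEnd e ∈ Λ.interior T)]
  rw [Finset.sum_eq_zero, zero_add]
  -- An edge with only its black end in U contributes M' - M ≤ M'; one with only its white end in U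
  -- contributes M - M' ≤ N - M' ≤ 2N - M'.
  · refine Finset.sum_le_sum fun e _ => ?_
    have := hM.le e
    unfold cutCost
    split_ifs <;> first | omega | tauto
  · intro e he
    have := hU e (by unfold frozen; convert he)
    simp [this]

/-- The cut criterion for patchability. -/
theorem patchable_of_cuts {S T : Finset (LVertex d)} {N : ℕ} {M M' : LEdge d D → ℕ}
    (hM : Λ.IsDimerCover S N M) (hM' : Λ.IsDimerCover S N M')
    (hF : ∀ e ∈ Λ.frozen S T, whiteEnd e ∈ Λ.interior S ∧ Λ.blackEnd e ∈ Λ.interior S)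
    (hcut : ∀ U ⊆ S, Λ.signedDiff S M M' U ≤ ∑ e ∈ Λ.free S T, Λ.cutCost N M' U e) :
    Λ.Patchable S T N M M' := by
  classical
  have hfreeE : ∀ e ∈ Λ.free S T, e ∈ Λ.edges S := fun e he =>
    Λ.mem_edgeFinset.1 (Finset.mem_filter.1 he).1
  set fr : LVertex d → ℕ := fun v => Λ.incidentSum (Λ.frozen S T) M' v with hfr
  -- Makes the truncated subtraction in the remaining demand exact. Frozen edges end at interior
  -- vertices, where M and M' both have multiplicity N.
  have hfr_le : ∀ v ∈ S, fr v ≤ Λ.vertexSum S M v := by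
    intro v hv
    by_cases h : fr v = 0
    · rw [h]
      exact Nat.zero_le _
    · have hvint : v ∈ Λ.interior S := by
        obtain ⟨e, he, -⟩ := Finset.exists_ne_zero_of_sum_ne_zero h
        obtain ⟨heF, hev⟩ := Finset.mem_filter.1 he
        rcases hev with rfl | rfl
        exacts [(hF e heF).1, (hF e heF).2]
      rw [hM.interior_eq v hvint, ← hM'.interior_eq v hvint,
        ← incidentSum_frozen_add_free Λ S T]
      exact Nat.le_add_right _ _
  set dem : LVertex d → ℕ := fun v => Λ.vertexSum S M v - fr v with hdem
  have hdemZ : ∀ v ∈ S, (dem v : ℤ) = (Λ.vertexSum S M v : ℕ) - (fr v : ℤ) := by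
    intro v hv
    rw [hdem]
    push_cast [hfr_le v hv]
    ring
  have hsum : ∀ U ⊆ S, ∑ v ∈ U, sign v * (dem v : ℤ) = Λ.signedDiff S M M' U +
      ∑ e ∈ Λ.free S T, (M' e : ℤ) *
        ((if whiteEnd e ∈ U then 1 else 0) - if Λ.blackEnd e ∈ U then 1 else 0) := by
    intro U hU
    rw [← sum_sign_mul_incidentSum, signedDiff, ← Finset.sum_add_distrib]
    refine Finset.sum_congr rfl fun v hv => ?_
    rw [hdemZ v (hU hv), ← incidentSum_natCast, ← incidentSum_frozen_add_free Λ S T M']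
    push_cast
    ring
  have htot : ∑ v ∈ S, sign v * (dem v : ℤ) = 0 := by
    have h0 : ∀ (f : LEdge d D → ℕ) (G : Finset (LEdge d D)), (∀ e ∈ G, e ∈ Λ.edges S) →
        ∑ v ∈ S, sign v * ((Λ.incidentSum G f v : ℕ) : ℤ) = 0 := by
      intro f G hG
      simp only [incidentSum_natCast]
      rw [sum_sign_mul_incidentSum]
      refine Finset.sum_eq_zero fun e he => ?_
      have h1 := (hG e he).1
      have h2 := (hG e he).2
      simp [h1, h2]
    have h1 := h0 M (Λ.edgeFinset S) fun e he => Λ.mem_edgeFinset.1 he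
    have h2 := h0 M' (Λ.frozen S T) fun e he => Λ.mem_edgeFinset.1 (Finset.mem_filter.1 he).1
    rw [Finset.sum_congr rfl fun v hv => by rw [hdemZ v hv]]
    simp only [mul_sub, Finset.sum_sub_distrib]
    rw [h2, sub_zero, ← h1]
    exact Finset.sum_congr rfl fun v _ => by rw [vertexSum_eq_incidentSum]
  set A := S.filter fun v => v.isLeft with hA
  set B := S.filter fun v => v.isRight with hB
  have hAsign : ∀ A' ⊆ A, ∑ v ∈ A', sign v * (dem v : ℤ) = ((∑ v ∈ A', dem v : ℕ) : ℤ) := by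
    intro A' hA'
    push_cast
    refine Finset.sum_congr rfl fun v hv => ?_
    have := (Finset.mem_filter.1 (hA' hv)).2
    rcases v with w | b
    · simp [sign]
    · simp at this
  have hBsign : ∀ B' ⊆ B, ∑ v ∈ B', sign v * (dem v : ℤ) = -((∑ v ∈ B', dem v : ℕ) : ℤ) := by
    intro B' hB'
    push_cast
    rw [← Finset.sum_neg_distrib]
    refine Finset.sum_congr rfl fun v hv => ?_
    have := (Finset.mem_filter.1 (hB' hv)).2
    rcases v with w | b
    · simp at this
    · simp [sign]
  have hAB : Disjoint A B := by
    rw [Finset.disjoint_left]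
    intro v hv hv'
    have h1 := (Finset.mem_filter.1 hv).2
    have h2 := (Finset.mem_filter.1 hv').2
    rcases v with w | b <;> simp_all
  have hS : S = A ∪ B := by
    ext v
    rcases v with w | b <;> simp [hA, hB]
  obtain ⟨f, hf0, hfA, hfB⟩ := exists_edge_weights_of_hall (Λ.free S T) whiteEnd Λ.blackEnd A B
    (fun e he => Finset.mem_filter.2 ⟨(hfreeE e he).2, rfl⟩) dem dem
    (by
      rw [hS, Finset.sum_union hAB, hAsign A subset_rfl, hBsign B subset_rfl] at htot
      omega)
    (by
      intro A' hA'
      set B' := ((Λ.free S T).filter fun e => whiteEnd e ∈ A').image Λ.blackEnd with hB'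
      have hB'B : B' ⊆ B := by
        intro v hv
        obtain ⟨e, he, rfl⟩ := Finset.mem_image.1 hv
        exact Finset.mem_filter.2 ⟨(hfreeE e (Finset.mem_filter.1 he).1).2, rfl⟩
      have hU : A' ∪ B' ⊆ S := by
        rw [hS]
        exact Finset.union_subset_union hA' hB'B
      have h1 := hsum _ hU
      rw [Finset.sum_union (hAB.mono hA' hB'B), hAsign A' hA', hBsign B' hB'B] at h1
      have h2 := hcut _ hU
      -- For a white set together with its free neighbours, no free edge has only its white end in
      -- U. The costs then cancel the contribution of M' edge by edge, and the cut inequality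
      -- becomes Hall's condition.
      have h3 : ∑ e ∈ Λ.free S T, Λ.cutCost N M' (A' ∪ B') e +
          ∑ e ∈ Λ.free S T, (M' e : ℤ) * ((if whiteEnd e ∈ A' ∪ B' then 1 else 0) -
            if Λ.blackEnd e ∈ A' ∪ B' then 1 else 0) ≤ 0 := by
        rw [← Finset.sum_add_distrib]
        refine Finset.sum_nonpos fun e he => ?_
        have h4 : whiteEnd e ∈ A' ∪ B' → Λ.blackEnd e ∈ A' ∪ B' := by
          intro h
          rcases Finset.mem_union.1 h with h | h
          · exact Finset.mem_union_right _ (Finset.mem_image_of_mem _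
              (Finset.mem_filter.2 ⟨he, h⟩))
          · have := (Finset.mem_filter.1 (hB'B h)).2
            simp [whiteEnd] at this
        unfold cutCost
        split_ifs <;> first | omega | tauto
      omega)
  have hfE : ∀ e, f e ≠ 0 → e ∈ Λ.free S T := fun e he => (hf0 e he).1
  set M'' : LEdge d D → ℕ := fun e => if e ∈ Λ.frozen S T then M' e else f e with hM''
  have hdisj : ∀ e ∈ Λ.free S T, e ∉ Λ.frozen S T := fun e he he' =>
    (Finset.mem_filter.1 he).2 (Finset.mem_filter.1 he').2
  have hv : ∀ v ∈ S, Λ.vertexSum S M'' v = Λ.vertexSum S M v := by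
    intro v hv
    rw [← incidentSum_frozen_add_free Λ S T]
    have h1 : Λ.incidentSum (Λ.frozen S T) M'' v = fr v :=
      Finset.sum_congr rfl fun e he => if_pos (Finset.mem_filter.1 he).1
    have h2 : Λ.incidentSum (Λ.free S T) M'' v = dem v := by
      have : Λ.incidentSum (Λ.free S T) M'' v = Λ.incidentSum (Λ.free S T) f v :=
        Finset.sum_congr rfl fun e he => if_neg (hdisj e (Finset.mem_filter.1 he).1)
      rw [this]
      cases hl : v.isLeft
      · have hr : v.isRight := by
          rcases v with w | b
          · simp at hl
          · rfl
        rw [incidentSum_blackEnd _ _ _ hr]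
        exact hfB v (Finset.mem_filter.2 ⟨hv, hr⟩)
      · rw [incidentSum_whiteEnd _ _ _ hl]
        exact hfA v (Finset.mem_filter.2 ⟨hv, hl⟩)
    rw [h1, h2]
    exact Nat.add_sub_cancel' (hfr_le v hv)
  refine ⟨M'', ⟨?_, ?_, ?_⟩, ?_, fun v hvb => hv v hvb.1⟩
  · intro e he
    have h1 : e ∉ Λ.frozen S T := fun h =>
      he (Λ.mem_edgeFinset.1 (Finset.mem_filter.1 h).1)
    rw [hM'']
    simp only [if_neg h1]
    by_contra h
    exact he (hfreeE e (hfE e h))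
  · intro v hvi
    rw [hv v hvi.1, hM.interior_eq v hvi]
  · intro v hvb
    rw [hv v hvb.1]
    exact hM.boundary_mem v hvb
  · intro e he h
    exact if_pos (Finset.mem_filter.2 ⟨Λ.mem_edgeFinset.2 he, h⟩)

end DimerLattice

/-! ### Cubes, translations and separated pairs -/

namespace DimerLattice

variable {d D : ℕ} (Λ : DimerLattice d D)

/-- The integer coordinates of a vertex. -/
def coord : LVertex d → Fin d → ℤ := Sum.elim id id

/-- The translate of a vertex by a lattice vector. -/
def translate (z : Fin d → ℤ) : LVertex d → LVertex d := Sum.map (· + z) (· + z)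

/-- The vertex at the origin with the same colour. -/
def base : LVertex d → LVertex d := Sum.map (fun _ => 0) (fun _ => 0)

@[simp] theorem coord_translate (z : Fin d → ℤ) (v : LVertex d) :
    coord (translate z v) = coord v + z := by
  rcases v with w | b <;> rfl

theorem translate_coord_base (v : LVertex d) : translate (coord v) (base v) = v := by
  rcases v with w | b <;> simp [translate, coord, base]

@[simp] theorem coord_base (v : LVertex d) : coord (base v) = 0 := by
  rcases v with w | b <;> rfl

theorem translate_translate (y z : Fin d → ℤ) (v : LVertex d) :
    translate y (translate z v) = translate (z + y) v := by
  rcases v with w | b <;> simp [translate, add_assoc]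

/-- The vertices whose integer coordinates differ by at most `r` from those of `c`. -/
noncomputable def cube (c : Fin d → ℤ) (r : ℤ) : Finset (LVertex d) :=
  (Finset.Icc (fun j => c j - r) fun j => c j + r).disjSum
    (Finset.Icc (fun j => c j - r) fun j => c j + r)

theorem mem_cube {c : Fin d → ℤ} {r : ℤ} {v : LVertex d} :
    v ∈ cube c r ↔ ∀ j, |coord v j - c j| ≤ r := by
  have h : ∀ x : Fin d → ℤ, (x ∈ Finset.Icc (fun j => c j - r) fun j => c j + r) ↔
      ∀ j, |x j - c j| ≤ r := by
    intro x
    simp only [Finset.mem_Icc, Pi.le_def, abs_le]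
    constructor
    · rintro ⟨h1, h2⟩ j
      have := h1 j
      have := h2 j
      constructor <;> linarith
    · intro h
      constructor <;> intro j <;> have := h j <;> linarith
  rcases v with w | b
  · simp only [cube, Finset.inl_mem_disjSum]
    exact h w
  · simp only [cube, Finset.inr_mem_disjSum]
    exact h b

theorem cube_mono (c : Fin d → ℤ) {r r' : ℤ} (h : r ≤ r') : cube c r ⊆ cube c r' := by
  intro v hv
  rw [mem_cube] at hv ⊢
  exact fun j => (hv j).trans h

theorem adj_iff {u v : LVertex d} : (latticeGraph Λ.shift).Adj u v ↔
    ∃ e : LEdge d D, (whiteEnd e = u ∧ Λ.blackEnd e = v) ∨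
      (whiteEnd e = v ∧ Λ.blackEnd e = u) := by
  simp only [latticeGraph, SimpleGraph.fromRel_adj, whiteEnd, blackEnd]
  constructor
  · rintro ⟨-, ⟨w, i, rfl, rfl⟩ | ⟨w, i, rfl, rfl⟩⟩
    · exact ⟨(w, i), Or.inl ⟨rfl, rfl⟩⟩
    · exact ⟨(w, i), Or.inr ⟨rfl, rfl⟩⟩
  · rintro ⟨⟨w, i⟩, ⟨rfl, rfl⟩ | ⟨rfl, rfl⟩⟩
    · exact ⟨Sum.inl_ne_inr, Or.inl ⟨w, i, rfl, rfl⟩⟩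
    · exact ⟨Sum.inr_ne_inl, Or.inr ⟨w, i, rfl, rfl⟩⟩

open Classical in
/-- The edges inside `Q` that are cut by `U`. -/
noncomputable def cutEdges (U : Set (LVertex d)) (Q : Finset (LVertex d)) : Finset (LEdge d D) :=
  (Λ.edgeFinset Q).filter fun e => ¬ (whiteEnd e ∈ U ↔ Λ.blackEnd e ∈ U)

theorem cutEdges_compl (U : Set (LVertex d)) (Q : Finset (LVertex d)) :
    Λ.cutEdges Uᶜ Q = Λ.cutEdges U Q := by
  classical
  ext e
  simp only [cutEdges, Finset.mem_filter, Set.mem_compl_iff]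
  tauto

theorem edges_mono {Q Q' : Finset (LVertex d)} (h : Q ⊆ Q') : Λ.edges Q ⊆ Λ.edges Q' :=
  fun _ he => ⟨h he.1, h he.2⟩

theorem cutEdges_mono (U : Set (LVertex d)) {Q Q' : Finset (LVertex d)} (h : Q ⊆ Q') :
    Λ.cutEdges U Q ⊆ Λ.cutEdges U Q' := by
  classical
  intro e he
  obtain ⟨h1, h2⟩ := Finset.mem_filter.1 he
  exact Finset.mem_filter.2 ⟨Λ.mem_edgeFinset.2 (Λ.edges_mono h (Λ.mem_edgeFinset.1 h1)), h2⟩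

theorem whiteEnd_translate (e : LEdge d D) (z : Fin d → ℤ) :
    whiteEnd (e.1 + z, e.2) = translate z (whiteEnd e) := rfl

theorem blackEnd_translate (e : LEdge d D) (z : Fin d → ℤ) :
    Λ.blackEnd (e.1 + z, e.2) = translate z (Λ.blackEnd e) := by
  simp only [blackEnd, translate, Sum.map_inr]
  congr 1
  abel

open Classical in
-- Every translated walk from U to its complement crosses a cut edge. For a fixed step of the walk,
-- the translated edge determines the translation, so each step accounts for at most one translation
-- per cut edge.
theorem card_translates_separated_le_of_walk {u v : LVertex d}
    (p : (latticeGraph Λ.shift).Walk u v)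
    (U : Set (LVertex d)) (Q : Finset (LVertex d)) (Z : Finset (Fin d → ℤ))
    (hQ : ∀ z ∈ Z, ∀ x ∈ p.support, translate z x ∈ Q) :
    (Z.filter fun z => translate z u ∈ U ∧ translate z v ∉ U).card ≤
      p.length * (Λ.cutEdges U Q).card := by
  induction p with
  | nil =>
    rw [Finset.filter_false_of_mem]
    · simp
    · rintro z - ⟨h1, h2⟩
      exact h2 h1
  | @cons u u' v h p ih =>
    have ih' := ih fun z hz x hx => hQ z hz x (by
      rw [SimpleGraph.Walk.support_cons]
      exact List.mem_cons_of_mem _ hx)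
    have hstep : (Z.filter fun z => translate z u ∈ U ∧ translate z u' ∉ U).card ≤
        (Λ.cutEdges U Q).card := by
      obtain ⟨e, he⟩ := Λ.adj_iff.1 h
      refine Finset.card_le_card_of_injOn (fun z => (e.1 + z, e.2)) ?_ ?_
      · intro z hz
        obtain ⟨hzZ, h1, h2⟩ := Finset.mem_filter.1 hz
        have hu : translate z u ∈ Q := hQ z hzZ u (by simp)
        have hu' : translate z u' ∈ Q := hQ z hzZ u' (by simp)
        refine Finset.mem_coe.2 (Finset.mem_filter.2 ⟨Λ.mem_edgeFinset.2 ?_, ?_⟩)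
        · refine ⟨?_, ?_⟩
          · rw [whiteEnd_translate]
            rcases he with ⟨he, -⟩ | ⟨he, -⟩ <;> rwa [he]
          · rw [blackEnd_translate]
            rcases he with ⟨-, he⟩ | ⟨-, he⟩ <;> rwa [he]
        · rw [whiteEnd_translate, blackEnd_translate]
          rcases he with ⟨he, he'⟩ | ⟨he, he'⟩ <;> rw [he, he'] <;> tauto
      · intro z _ z' _ hzz
        exact add_left_cancel (Prod.mk.inj hzz).1
    have hsub : (Z.filter fun z => translate z u ∈ U ∧ translate z v ∉ U) ⊆
        (Z.filter fun z => translate z u ∈ U ∧ translate z u' ∉ U) ∪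
        (Z.filter fun z => translate z u' ∈ U ∧ translate z v ∉ U) := by
      intro z hz
      simp only [Finset.mem_union, Finset.mem_filter] at hz ⊢
      tauto
    calc _ ≤ _ := Finset.card_le_card hsub
      _ ≤ _ := Finset.card_union_le _ _
      _ ≤ (Λ.cutEdges U Q).card + p.length * (Λ.cutEdges U Q).card := Nat.add_le_add hstep ih'
      _ = _ := by rw [SimpleGraph.Walk.length_cons]; ring

/-- `s` bounds the extent of edges and of suitable walks between nearby vertices. -/
def IsRange (s : ℕ) : Prop :=
  (∀ i j, |Λ.shift i j| ≤ s) ∧ ∀ u ∈ cube (0 : Fin d → ℤ) 1, ∀ v ∈ cube (0 : Fin d → ℤ) 1,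
    ∃ p : (latticeGraph Λ.shift).Walk u v, p.length ≤ s ∧ ∀ x ∈ p.support, x ∈ cube 0 s

/-- Connectedness provides the walks; one bound serves them all because the unit cube is finite. -/
theorem exists_isRange : ∃ s, 0 < s ∧ Λ.IsRange s := by
  classical
  have hw : ∀ u v : LVertex d, ∃ s : ℕ, ∃ p : (latticeGraph Λ.shift).Walk u v,
      p.length ≤ s ∧ ∀ x ∈ p.support, x ∈ cube 0 s := by
    intro u v
    obtain ⟨p⟩ := Λ.connected.preconnected u v
    let m : ℕ := p.support.toFinset.sup fun x => Finset.univ.sup fun j => (coord x j).natAbs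
    refine ⟨max p.length m, p, le_max_left _ _, fun x hx => ?_⟩
    rw [mem_cube]
    intro j
    have h1 : (coord x j).natAbs ≤ Finset.univ.sup fun j => (coord x j).natAbs :=
      Finset.le_sup (f := fun j => (coord x j).natAbs) (Finset.mem_univ j)
    have h2 : (Finset.univ.sup fun j => (coord x j).natAbs) ≤ m :=
      Finset.le_sup (f := fun x : LVertex d => Finset.univ.sup fun j => (coord x j).natAbs)
        (List.mem_toFinset.2 hx)
    have h3 : (coord x j).natAbs ≤ max p.length m := (h1.trans h2).trans (le_max_right _ _)
    simp only [Pi.zero_apply, sub_zero, Int.abs_eq_natAbs]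
    exact_mod_cast h3
  choose f p hp hps using hw
  let s1 : ℕ := (cube (0 : Fin d → ℤ) 1).sup fun u => (cube (0 : Fin d → ℤ) 1).sup fun v => f u v
  let s2 : ℕ := Finset.univ.sup fun i => Finset.univ.sup fun j => (Λ.shift i j).natAbs
  refine ⟨max s1 s2 + 1, Nat.succ_pos _, ?_, ?_⟩
  · intro i j
    have h1 : (Λ.shift i j).natAbs ≤ Finset.univ.sup fun j => (Λ.shift i j).natAbs :=
      Finset.le_sup (f := fun j => (Λ.shift i j).natAbs) (Finset.mem_univ j)
    have h2 : (Finset.univ.sup fun j => (Λ.shift i j).natAbs) ≤ s2 :=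
      Finset.le_sup (f := fun i => Finset.univ.sup fun j => (Λ.shift i j).natAbs)
        (Finset.mem_univ i)
    have h3 : (Λ.shift i j).natAbs ≤ max s1 s2 + 1 :=
      ((h1.trans h2).trans (le_max_right _ _)).trans (Nat.le_succ _)
    rw [Int.abs_eq_natAbs]
    exact_mod_cast h3
  · intro u hu v hv
    have h1 : f u v ≤ (cube (0 : Fin d → ℤ) 1).sup fun v => f u v :=
      Finset.le_sup (f := fun v => f u v) hv
    have h2 : ((cube (0 : Fin d → ℤ) 1).sup fun v => f u v) ≤ s1 :=
      Finset.le_sup (f := fun u => (cube (0 : Fin d → ℤ) 1).sup fun v => f u v) hu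
    have h3 : f u v ≤ max s1 s2 + 1 := ((h1.trans h2).trans (le_max_left _ _)).trans (Nat.le_succ _)
    exact ⟨p u v, (hp u v).trans h3, fun x hx => cube_mono 0 (by exact_mod_cast h3) (hps u v x hx)⟩

variable {Λ}

theorem base_mem_cube (v : LVertex d) : base v ∈ cube (0 : Fin d → ℤ) 1 := by
  rw [mem_cube]
  intro j
  simp

theorem translate_mem_cube {c z : Fin d → ℤ} {r s : ℤ} {x : LVertex d}
    (hx : x ∈ cube 0 s) (hz : ∀ j, |z j - c j| ≤ r) : translate z x ∈ cube c (r + s) := by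
  rw [mem_cube] at hx ⊢
  intro j
  have h1 := hx j
  have h2 := hz j
  simp only [Pi.zero_apply, sub_zero] at h1
  rw [coord_translate, Pi.add_apply]
  have h3 := abs_add_le (coord x j) (z j - c j)
  have h4 : coord x j + z j - c j = coord x j + (z j - c j) := by ring
  rw [h4]
  linarith

open Classical in
/-- Few pairs of vertices that differ by a fixed translation are separated by a set with a small
cut. -/
theorem card_translates_separated_le {s : ℕ} (hs : Λ.IsRange s) (U : Set (LVertex d))
    (c : Fin d → ℤ) (r : ℤ) (u v : LVertex d) :
    ∀ (m : ℕ) (t : Fin d → ℤ) (_ : ∑ j, (t j).natAbs = m) (Z : Finset (Fin d → ℤ))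
      (_ : ∀ z ∈ Z, ∀ j, |z j - c j| ≤ r) (_ : ∀ z ∈ Z, ∀ j, |z j + t j - c j| ≤ r),
      (Z.filter fun z => translate z (base u) ∈ U ∧ translate (z + t) (base v) ∉ U).card ≤
        (m + 1) * s * (Λ.cutEdges U (cube c (r + s))).card := by
  have hstep : ∀ (u v : LVertex d) (_ : u ∈ cube (0 : Fin d → ℤ) 1)
      (_ : v ∈ cube (0 : Fin d → ℤ) 1) (Z : Finset (Fin d → ℤ))
      (_ : ∀ z ∈ Z, ∀ j, |z j - c j| ≤ r),
      (Z.filter fun z => translate z u ∈ U ∧ translate z v ∉ U).card ≤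
        s * (Λ.cutEdges U (cube c (r + s))).card := by
    intro u v hu hv Z hZ
    obtain ⟨p, hp, hps⟩ := hs.2 u hu v hv
    exact (Λ.card_translates_separated_le_of_walk p U _ Z fun z hz x hx =>
      translate_mem_cube (hps x hx) (hZ z hz)).trans (Nat.mul_le_mul_right _ hp)
  intro m
  induction m with
  | zero =>
    intro t ht Z hZ hZt
    have ht0 : t = 0 := by
      funext j
      have := (Finset.sum_eq_zero_iff.1 ht) j (Finset.mem_univ j)
      exact Int.natAbs_eq_zero.1 this
    subst ht0
    simpa using hstep (base u) (base v) (base_mem_cube u) (base_mem_cube v) Z hZ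
  | succ m ih =>
    intro t ht Z hZ hZt
    obtain ⟨j, hj⟩ : ∃ j, t j ≠ 0 := by
      by_contra! h
      simp [h] at ht
    let τ : Fin d → ℤ := Pi.single j (t j).sign
    have hτj : τ j = (t j).sign := by simp [τ]
    have hτi : ∀ i, i ≠ j → τ i = 0 := fun i hi => by simp [τ, hi]
    have hsg : (t j).sign = 1 ∧ 0 < t j ∨ (t j).sign = -1 ∧ t j < 0 := by
      rcases lt_trichotomy (t j) 0 with h | h | h
      · exact Or.inr ⟨Int.sign_eq_neg_one_of_neg h, h⟩
      · exact absurd h hj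
      · exact Or.inl ⟨Int.sign_eq_one_of_pos h, h⟩
    have hm : ∑ i, ((t - τ) i).natAbs = m := by
      rw [← Finset.add_sum_erase _ _ (Finset.mem_univ j)] at ht ⊢
      have h1 : ∑ i ∈ Finset.univ.erase j, ((t - τ) i).natAbs =
          ∑ i ∈ Finset.univ.erase j, (t i).natAbs :=
        Finset.sum_congr rfl fun i hi => by
          rw [Pi.sub_apply, hτi i (Finset.ne_of_mem_erase hi), sub_zero]
      rw [h1, Pi.sub_apply, hτj]
      rcases hsg with ⟨h, h'⟩ | ⟨h, h'⟩ <;> rw [h] <;> omega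
    have hZτ : ∀ z ∈ Z, ∀ i, |z i + τ i - c i| ≤ r := by
      intro z hz i
      by_cases hi : i = j
      · subst hi
        rw [hτj]
        have h1 := hZ z hz i
        have h2 := hZt z hz i
        rw [abs_le] at h1 h2 ⊢
        rcases hsg with ⟨h, h'⟩ | ⟨h, h'⟩ <;> rw [h] <;> constructor <;> omega
      · rw [hτi i hi, add_zero]
        exact hZ z hz i
    have hτ1 : translate τ (base u) ∈ cube (0 : Fin d → ℤ) 1 := by
      rw [mem_cube]
      intro i
      simp only [coord_translate, coord_base, zero_add, Pi.zero_apply, sub_zero]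
      by_cases hi : i = j
      · subst hi
        rw [hτj]
        rcases hsg with ⟨h, -⟩ | ⟨h, -⟩ <;> rw [h] <;> simp
      · rw [hτi i hi]
        simp
    have h1 := hstep (base u) (translate τ (base u)) (base_mem_cube u) hτ1 Z hZ
    let Z' := Z.map (addRightEmbedding τ)
    have h2 := ih (t - τ) hm Z' (by
        intro z hz i
        obtain ⟨y, hy, rfl⟩ := Finset.mem_map.1 hz
        exact hZτ y hy i) (by
        intro z hz i
        obtain ⟨y, hy, rfl⟩ := Finset.mem_map.1 hz
        have := hZt y hy i
        simpa [add_assoc] using this)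
    have h3 : (Z.filter fun z => translate z (base u) ∈ U ∧ translate (z + t) (base v) ∉ U) ⊆
        (Z.filter fun z => translate z (base u) ∈ U ∧ translate z (translate τ (base u)) ∉ U) ∪
        (Z.filter fun z => translate (z + τ) (base u) ∈ U ∧
          translate (z + τ + (t - τ)) (base v) ∉ U) := by
      intro z hz
      simp only [Finset.mem_union, Finset.mem_filter, translate_translate] at hz ⊢
      rw [add_comm τ z, add_add_sub_cancel]
      tauto
    have h4 : (Z.filter fun z => translate (z + τ) (base u) ∈ U ∧
          translate (z + τ + (t - τ)) (base v) ∉ U).card =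
        (Z'.filter fun z => translate z (base u) ∈ U ∧
          translate (z + (t - τ)) (base v) ∉ U).card := by
      rw [Finset.filter_map, Finset.card_map]
      rfl
    calc _ ≤ _ := Finset.card_le_card h3
      _ ≤ _ := Finset.card_union_le _ _
      _ ≤ s * (Λ.cutEdges U (cube c (r + s))).card +
          (m + 1) * s * (Λ.cutEdges U (cube c (r + s))).card := by
        rw [h4]
        exact Nat.add_le_add h1 h2
      _ = _ := by ring

end DimerLattice

/-! ### Isoperimetric and Poincaré inequalities in cubes -/

namespace DimerLattice

variable {d D : ℕ} {Λ : DimerLattice d D}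

theorem base_eq_of_isLeft_eq {x y : LVertex d} (h : x.isLeft = y.isLeft) : base x = base y := by
  rcases x with x | x <;> rcases y with y | y <;> simp_all [base]

theorem eq_of_coord_eq {x y : LVertex d} (h : x.isLeft = y.isLeft) (h' : coord x = coord y) :
    x = y := by
  rw [← translate_coord_base x, ← translate_coord_base y, h', base_eq_of_isLeft_eq h]

/-- Sort the pairs by the two colours and the displacement, giving at most `4 * T.card` classes.
Within a class a pair is determined by the coordinates of its first vertex, so the bound for a fixed
displacement applies. -/
theorem card_separated_pairs_le {s : ℕ} (hs : Λ.IsRange s) (U : Set (LVertex d))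
    (c : Fin d → ℤ) (r : ℤ) (T : Finset (Fin d → ℤ)) (m : ℕ)
    (hT : ∀ t ∈ T, ∑ j, (t j).natAbs ≤ m) (P : Finset (LVertex d × LVertex d))
    (hP : ∀ p ∈ P, p.1 ∈ U ∧ p.2 ∉ U ∧ p.1 ∈ cube c r ∧ p.2 ∈ cube c r ∧
      coord p.2 - coord p.1 ∈ T) :
    P.card ≤ (m + 1) * s * (Λ.cutEdges U (cube c (r + s))).card * (4 * T.card) := by
  classical
  let f : LVertex d × LVertex d → Bool × Bool × (Fin d → ℤ) := fun p =>
    (p.1.isLeft, p.2.isLeft, coord p.2 - coord p.1)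
  have himg : (P.image f).card ≤ 4 * T.card := by
    have : P.image f ⊆ (Finset.univ : Finset Bool) ×ˢ (Finset.univ : Finset Bool) ×ˢ T := by
      intro a ha
      obtain ⟨p, hp, rfl⟩ := Finset.mem_image.1 ha
      simp only [Finset.mem_product, Finset.mem_univ, true_and, f]
      exact (hP p hp).2.2.2.2
    refine (Finset.card_le_card this).trans (le_of_eq ?_)
    rw [Finset.card_product, Finset.card_product, Finset.card_univ, Fintype.card_bool]
    ring
  refine (Finset.card_le_mul_card_image (f := f) P _ ?_).trans (Nat.mul_le_mul_left _ himg)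
  intro a ha
  obtain ⟨⟨x, y⟩, hp, rfl⟩ := Finset.mem_image.1 ha
  have hxy := hP _ hp
  set t : Fin d → ℤ := coord y - coord x with ht
  let Z : Finset (Fin d → ℤ) := (P.filter fun p => f p = f (x, y)).image fun p => coord p.1
  have hZ : ∀ z ∈ Z, (∀ j, |z j - c j| ≤ r) ∧ (∀ j, |z j + t j - c j| ≤ r) ∧
      translate z (base x) ∈ U ∧ translate (z + t) (base y) ∉ U := by
    intro z hz
    obtain ⟨⟨x', y'⟩, hp', rfl⟩ := Finset.mem_image.1 hz
    obtain ⟨hp'P, hf⟩ := Finset.mem_filter.1 hp'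
    have hx : x'.isLeft = x.isLeft := congrArg Prod.fst hf
    have hy : y'.isLeft = y.isLeft := congrArg (fun a => a.2.1) hf
    have hd : coord y' - coord x' = t := congrArg (fun a => a.2.2) hf
    have hxy' := hP _ hp'P
    have hsum : coord x' + t = coord y' := by rw [← hd]; abel
    refine ⟨mem_cube.1 hxy'.2.2.1, ?_, ?_, ?_⟩
    · intro j
      have := mem_cube.1 hxy'.2.2.2.1 j
      rw [← hsum] at this
      exact this
    · rw [← base_eq_of_isLeft_eq hx, translate_coord_base]
      exact hxy'.1
    · rw [hsum, ← base_eq_of_isLeft_eq hy, translate_coord_base]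
      exact hxy'.2.1
  have h1 := card_translates_separated_le hs U c r x y _ t rfl Z (fun z hz => (hZ z hz).1)
    fun z hz => (hZ z hz).2.1
  rw [Finset.filter_true_of_mem fun z hz => (hZ z hz).2.2] at h1
  have h2 : (P.filter fun p => f p = f (x, y)).card = Z.card := by
    rw [Finset.card_image_of_injOn]
    rintro ⟨x1, y1⟩ h1 ⟨x2, y2⟩ h2 h
    have h1' := (Finset.mem_filter.1 h1).2
    have h2' := (Finset.mem_filter.1 h2).2
    have hf : f (x1, y1) = f (x2, y2) := h1'.trans h2'.symm
    have hc : coord x1 = coord x2 := h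
    have hx : x1.isLeft = x2.isLeft := congrArg Prod.fst hf
    have hy : y1.isLeft = y2.isLeft := congrArg (fun a => a.2.1) hf
    have hd : coord y1 - coord x1 = coord y2 - coord x2 := congrArg (fun a => a.2.2) hf
    rw [hc, sub_left_inj] at hd
    rw [eq_of_coord_eq hx hc, eq_of_coord_eq hy hd]
  rw [h2]
  refine h1.trans ?_
  gcongr
  exact hT t hxy.2.2.2.2

open Classical in
/-- The number of vertices of `U` in a cube. -/
noncomputable def cubeCount (U : Set (LVertex d)) (c : Fin d → ℤ) (r : ℤ) : ℕ :=
  ((cube c r).filter fun v => v ∈ U).card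

theorem cubeCount_mono (U : Set (LVertex d)) (c : Fin d → ℤ) : Monotone (cubeCount U c) := by
  classical
  exact fun _ _ h => Finset.card_le_card (Finset.filter_subset_filter _ (cube_mono c h))

theorem cubeCount_eq_zero {U : Set (LVertex d)} {c : Fin d → ℤ} {r : ℤ}
    (h : cubeCount U c r = 0) {v : LVertex d} (hv : v ∈ cube c r) : v ∉ U := by
  classical
  intro hU
  exact Finset.notMem_empty v (Finset.card_eq_zero.1 h ▸ Finset.mem_filter.2 ⟨hv, hU⟩)

/-- A relative isoperimetric inequality in cubes. -/
theorem cubeCount_mul_cubeCount_compl_le {s : ℕ} (hs : Λ.IsRange s) (U : Set (LVertex d))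
    (c : Fin d → ℤ) (r : ℕ) :
    cubeCount U c r * cubeCount Uᶜ c r ≤
      (2 * r * d + 1) * s * (Λ.cutEdges U (cube c (r + s))).card * (4 * (4 * r + 1) ^ d) := by
  classical
  -- Every pair in U × Uᶜ inside the cube is a separated pair, with displacement at most 2r in each
  -- coordinate.
  let T : Finset (Fin d → ℤ) := Fintype.piFinset fun _ => Finset.Icc (-(2 * r : ℤ)) (2 * r)
  have hTc : T.card = (4 * r + 1) ^ d := by
    simp only [T, Fintype.card_piFinset, Int.card_Icc, Finset.prod_const, Finset.card_univ,
      Fintype.card_fin]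
    congr 1
    omega
  have h := card_separated_pairs_le hs U c r T (2 * r * d) ?_
    (((cube c (r : ℤ)).filter fun v => v ∈ U) ×ˢ ((cube c (r : ℤ)).filter fun v => v ∈ Uᶜ)) ?_
  · rw [Finset.card_product, hTc] at h
    unfold cubeCount
    convert h
  · intro t ht
    have h1 : ∀ j ∈ (Finset.univ : Finset (Fin d)), (t j).natAbs ≤ 2 * r := by
      intro j _
      have := Finset.mem_Icc.1 (Fintype.mem_piFinset.1 ht j)
      omega
    refine (Finset.sum_le_card_nsmul _ _ _ h1).trans (le_of_eq ?_)
    rw [Finset.card_univ, Fintype.card_fin, smul_eq_mul, mul_comm]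
  · rintro ⟨x, y⟩ hp
    obtain ⟨hx, hy⟩ := Finset.mem_product.1 hp
    obtain ⟨hx, hxU⟩ := Finset.mem_filter.1 hx
    obtain ⟨hy, hyU⟩ := Finset.mem_filter.1 hy
    refine ⟨hxU, hyU, hx, hy, Fintype.mem_piFinset.2 fun j => ?_⟩
    have h1 := abs_le.1 (mem_cube.1 hx j)
    have h2 := abs_le.1 (mem_cube.1 hy j)
    rw [Finset.mem_Icc, Pi.sub_apply]
    constructor <;> linarith

/-- A Poincaré inequality for sets with few vertices in a cube. -/
theorem cubeCount_sub_le {s : ℕ} (hs : Λ.IsRange s) (W : Set (LVertex d))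
    (c : Fin d → ℤ) (r : ℤ) (l : ℕ) (hl : 1 ≤ l) (hW : 2 * cubeCount W c r ≤ l ^ d) :
    cubeCount W c (r - l) ≤
      8 * (d + 1) * s * l * (Λ.cutEdges W (cube c (r + s))).card := by
  classical
  -- Average over the l^d translations with coordinates in [0, l). A vertex of W in the smaller cube
  -- has at most l^d / 2 translates in W, so at least half of its translates are separated from it;
  -- the common factor l^d cancels against the upper bound for separated pairs.
  let T : Finset (Fin d → ℤ) := Fintype.piFinset fun _ => Finset.Ico (0 : ℤ) l
  have hTc : T.card = l ^ d := by
    simp [T, Fintype.card_piFinset]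
  set A : Finset (LVertex d) := (cube c (r - l)).filter fun v => v ∈ W with hA
  have hcube : ∀ x ∈ A, ∀ t ∈ T, translate t x ∈ cube c r := by
    intro x hx t ht
    rw [mem_cube]
    intro j
    have h1 := abs_le.1 (mem_cube.1 (Finset.mem_filter.1 hx).1 j)
    have h2 := Finset.mem_Ico.1 (Fintype.mem_piFinset.1 ht j)
    rw [coord_translate, Pi.add_apply, abs_le]
    constructor <;> linarith
  let P0 := (A ×ˢ T).filter fun p => translate p.2 p.1 ∉ W
  let P : Finset (LVertex d × LVertex d) := P0.image fun p => (p.1, translate p.2 p.1)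
  have hPc : P.card = P0.card := by
    rw [Finset.card_image_of_injective]
    rintro ⟨x, t⟩ ⟨x', t'⟩ h
    obtain ⟨rfl, h2⟩ := Prod.mk.inj h
    have := congrArg coord h2
    simp only [coord_translate, add_right_inj] at this
    rw [this]
  have hlow : A.card * l ^ d ≤ 2 * P0.card := by
    have h1 : P0.card = ∑ x ∈ A, (T.filter fun t => translate t x ∉ W).card := by
      simp only [P0, Finset.card_filter, Finset.sum_product]
    rw [h1, Finset.mul_sum, ← smul_eq_mul]
    refine Finset.card_nsmul_le_sum _ _ _ fun x hx => ?_
    have h2 : (T.filter fun t => translate t x ∈ W).card ≤ cubeCount W c r := by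
      refine Finset.card_le_card_of_injOn (fun t => translate t x) ?_ ?_
      · intro t ht
        obtain ⟨ht, htW⟩ := Finset.mem_filter.1 ht
        exact Finset.mem_coe.2 (Finset.mem_filter.2 ⟨hcube x hx t ht, htW⟩)
      · intro t _ t' _ h
        have := congrArg coord h
        simpa only [coord_translate, add_right_inj] using this
    have h3 := Finset.card_filter_add_card_filter_not (s := T) (fun t => translate t x ∈ W)
    rw [hTc] at h3
    omega
  have hup := card_separated_pairs_le hs W c r T (d * l) ?_ P ?_
  · rw [hPc, hTc] at hup
    have h1 : A.card * l ^ d ≤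
        (2 * ((d * l + 1) * s * (Λ.cutEdges W (cube c (r + s))).card * 4)) * l ^ d := by
      calc A.card * l ^ d ≤ 2 * P0.card := hlow
        _ ≤ _ := Nat.mul_le_mul_left 2 hup
        _ = _ := by ring
    have h2 := Nat.le_of_mul_le_mul_right h1 (pow_pos (by omega) d)
    refine h2.trans ?_
    have h3 : d * l + 1 ≤ (d + 1) * l := by nlinarith
    calc 2 * ((d * l + 1) * s * (Λ.cutEdges W (cube c (r + s))).card * 4)
        ≤ 2 * (((d + 1) * l) * s * (Λ.cutEdges W (cube c (r + s))).card * 4) := by gcongr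
      _ = _ := by ring
  · intro t ht
    have h1 : ∀ j ∈ (Finset.univ : Finset (Fin d)), (t j).natAbs ≤ l := by
      intro j _
      have := Finset.mem_Ico.1 (Fintype.mem_piFinset.1 ht j)
      omega
    refine (Finset.sum_le_card_nsmul _ _ _ h1).trans (le_of_eq ?_)
    rw [Finset.card_univ, Fintype.card_fin, smul_eq_mul]
  · intro p hp
    obtain ⟨⟨x, t⟩, hxt, rfl⟩ := Finset.mem_image.1 hp
    obtain ⟨hxt, hW'⟩ := Finset.mem_filter.1 hxt
    obtain ⟨hx, ht⟩ := Finset.mem_product.1 hxt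
    obtain ⟨hxc, hxW⟩ := Finset.mem_filter.1 hx
    exact ⟨hxW, hW', cube_mono c (by omega) hxc, hcube x hx t ht, by
      simpa using ht⟩

end DimerLattice

/-! ### Iteration over dyadic scales -/

/-- A De Giorgi type iteration over dyadic scales. -/
theorem eq_zero_of_dyadic_decay (w : ℤ → ℕ) (hw : Monotone w) (d C s : ℕ) (hC : 0 < C) (R₀ : ℤ)
    (h : ∀ r ≤ R₀, ∀ l : ℕ, 1 ≤ l → 2 * w r ≤ l ^ d → w (r - l) ≤ C * l * (w (r + s) - w r)) :
    ∀ (j : ℕ) (R : ℤ), R ≤ R₀ → 2 * w R ≤ (2 ^ j) ^ d →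
      w (R - 2 * (2 ^ d * C * s + 1) * 2 ^ j) = 0 := by
  have hone : ∀ (l : ℕ) (R : ℤ), 1 ≤ l → R ≤ R₀ → 2 * w R ≤ l ^ d →
      2 ^ d * w (R - (2 ^ d * C * s + 1) * l) ≤ w R := by
    intro l R hl hR hwR
    -- Sum the hypothesis over m radii spaced by s and ending below R. Each left side is at least x
    -- by monotonicity, while the right sides telescope to at most C l w(R). The choice of m turns
    -- this into 2^d x ≤ w(R).
    set m : ℕ := 2 ^ d * C * l with hm
    have hmpos : 0 < C * l := Nat.mul_pos hC hl
    set x := w (R - (2 ^ d * C * s + 1) * l) with hx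
    have hsum : ∀ k : ℕ, k ≤ m → (k : ℕ) * x + C * l * w (R - m * s) ≤
        C * l * w (R - m * s + k * s) := by
      intro k
      induction k with
      | zero => intro _; simp
      | succ k ih =>
        intro hk
        have ih' := ih (by omega)
        have hks : ((k : ℤ) + 1) * s ≤ m * s := by
          have : (k : ℤ) + 1 ≤ m := by exact_mod_cast hk
          exact mul_le_mul_of_nonneg_right this (by positivity)
        have hs0 : (0 : ℤ) ≤ s := by positivity
        have hr : R - m * s + k * s ≤ R₀ := by linarith
        have h1 := h (R - m * s + k * s) hr l hl ((Nat.mul_le_mul_left 2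
          (hw (by linarith))).trans hwR)
        have h2 : x ≤ w (R - m * s + k * s - l) := by
          refine hw ?_
          have : (0 : ℤ) ≤ k * s := by positivity
          rw [hm]
          push_cast
          nlinarith
        have h3 : w (R - m * s + k * s) ≤ w (R - m * s + k * s + s) := hw (by linarith)
        have h4 : R - m * s + ((k + 1 : ℕ) : ℤ) * s = R - m * s + k * s + s := by push_cast; ring
        rw [h4]
        obtain ⟨δ, hδ⟩ := Nat.exists_eq_add_of_le h3
        rw [hδ] at h1 ⊢
        rw [Nat.add_sub_cancel_left] at h1
        have := h2.trans h1
        calc (k + 1) * x + C * l * w (R - m * s) = (k * x + C * l * w (R - m * s)) + x := by ring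
          _ ≤ C * l * w (R - m * s + k * s) + C * l * δ := Nat.add_le_add ih' this
          _ = _ := by ring
    have h5 := hsum m le_rfl
    rw [sub_add_cancel] at h5
    have h6 : C * l * (2 ^ d * x) ≤ C * l * w R := by
      calc C * l * (2 ^ d * x) = m * x := by rw [hm]; ring
        _ ≤ _ := le_trans (Nat.le_add_right _ _) h5
    exact Nat.le_of_mul_le_mul_left h6 hmpos
  intro j
  induction j with
  | zero =>
    intro R hR hwR
    -- At scale one the hypothesis reads 2w ≤ 1, and w is a natural number.
    have h0 : w R = 0 := by
      have : ((2 ^ 0) ^ d : ℕ) = 1 := by simp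
      omega
    have h1 : (0 : ℤ) ≤ 2 * (2 ^ d * C * s + 1) * 2 ^ 0 := by positivity
    have h2 := hw (sub_le_self R h1)
    omega
  | succ j ih =>
    intro R hR hwR
    -- The gain of 2^d is exactly what is needed to pass to half the scale. The radii lost form a
    -- geometric series, whence the factor 2 in the conclusion.
    have h1 := hone (2 ^ (j + 1)) R Nat.one_le_two_pow hR hwR
    have h2 : 2 * w (R - (2 ^ d * C * s + 1) * ((2 ^ (j + 1) : ℕ) : ℤ)) ≤ (2 ^ j) ^ d := by
      have h3 : 2 ^ d * (2 * w (R - (2 ^ d * C * s + 1) * ((2 ^ (j + 1) : ℕ) : ℤ))) ≤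
          2 ^ d * (2 ^ j) ^ d := by
        calc _ = 2 * (2 ^ d * w (R - (2 ^ d * C * s + 1) * ((2 ^ (j + 1) : ℕ) : ℤ))) := by ring
          _ ≤ 2 * w R := Nat.mul_le_mul_left 2 h1
          _ ≤ _ := hwR
          _ = _ := by rw [pow_succ, mul_pow, mul_comm]
      exact Nat.le_of_mul_le_mul_left h3 (by positivity)
    have hpos : (0 : ℤ) ≤ (2 ^ d * C * s + 1) * ((2 ^ (j + 1) : ℕ) : ℤ) := by positivity
    have h4 := ih _ (by linarith) h2
    rw [← h4]
    congr 1
    push_cast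
    ring

/-- Isolates the scale dependence: at radius `k * l` the isoperimetric factor is at most a constant
times l^(d+1). -/
theorem isoperimetric_factor_le (k d l s : ℕ) (hl : 1 ≤ l) (x y : ℕ) (hxy : x ≤ y) :
    (2 * (k * l) * d + 1) * s * x * (4 * (4 * (k * l) + 1) ^ d) ≤
      (2 * k * d + 1) * s * (4 * (4 * k + 1) ^ d) * l ^ d * (y * l) := by
  have h1 : 2 * (k * l) * d + 1 ≤ (2 * k * d + 1) * l := by
    calc 2 * (k * l) * d + 1 ≤ 2 * (k * l) * d + l := Nat.add_le_add_left hl _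
      _ = _ := by ring
  have h2 : (4 * (k * l) + 1) ^ d ≤ ((4 * k + 1) * l) ^ d := by
    refine Nat.pow_le_pow_left ?_ d
    calc 4 * (k * l) + 1 ≤ 4 * (k * l) + l := Nat.add_le_add_left hl _
      _ = _ := by ring
  calc (2 * (k * l) * d + 1) * s * x * (4 * (4 * (k * l) + 1) ^ d)
      ≤ ((2 * k * d + 1) * l) * s * y * (4 * ((4 * k + 1) * l) ^ d) :=
        Nat.mul_le_mul (Nat.mul_le_mul (Nat.mul_le_mul_right s h1) hxy) (Nat.mul_le_mul_left 4 h2)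
    _ = _ := by
      rw [mul_pow]
      ring

/-! ### The clearing-out lemma -/

namespace DimerLattice

variable {d D : ℕ} {Λ : DimerLattice d D}

/-- A clearing-out lemma: a quasi-minimal set with a small cut in a large cube is trivial in a
concentric cube. -/
theorem exists_clearing {s : ℕ} (hs : Λ.IsRange s) (a B : ℝ) (ha : 0 < a) (hB : 0 ≤ B) :
    ∃ (K : ℕ) (c₀ : ℝ), 0 < c₀ ∧ 1 ≤ K ∧ ∀ (j : ℕ) (c : Fin d → ℤ) (U : Set (LVertex d)),
      (∀ W, W = U ∨ W = Uᶜ → ∀ r : ℤ, r ≤ K * 2 ^ j →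
        a * (Λ.cutEdges W (cube c r)).card ≤
          B * ((cubeCount W c (r + s) : ℝ) - cubeCount W c r)) →
      ((Λ.cutEdges U (cube c (K * 2 ^ j))).card : ℝ) * 2 ^ j ≤ c₀ * (2 ^ j) ^ d →
      (∀ v ∈ cube c (2 ^ j), v ∈ U) ∨ ∀ v ∈ cube c (2 ^ j), v ∉ U := by
  -- The Poincaré constant times the quasi-minimality ratio B / a, with 1 added for positivity.
  set C : ℕ := ⌈8 * (d + 1) * s * (B / a)⌉₊ + 1 with hC
  have hCle : 8 * (d + 1) * s * (B / a) ≤ (C : ℝ) := by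
    rw [hC]
    push_cast
    exact (Nat.le_ceil _).trans (by linarith)
  -- The iteration runs with step 2s, since the cut at radius r + s is controlled by the count at r
  -- + 2s. It loses 2 K₁ 2^j of radius, so starting at k 2^j leaves 2^j.
  set K₁ : ℕ := 2 ^ d * C * (2 * s) + 1 with hK₁
  set k : ℕ := 2 * K₁ + 1 with hk
  set C' : ℕ := (2 * k * d + 1) * s * (4 * (4 * k + 1) ^ d) with hC'
  -- With this c₀ the isoperimetric inequality keeps the product of the counts of U and Uᶜ below a
  -- quarter of l^(2d). One of them is then at most l^d / 2, which starts the iteration.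
  refine ⟨k + s, 1 / (4 * C' + 1), by positivity, by omega, ?_⟩
  intro j c U hopt hcut
  set l : ℕ := 2 ^ j with hl
  have hl1 : 1 ≤ l := Nat.one_le_two_pow
  have hlZ : ((2 : ℤ) ^ j) = (l : ℤ) := by rw [hl]; push_cast; rfl
  have hlR : ((2 : ℝ) ^ j) = (l : ℝ) := by rw [hl]; push_cast; rfl
  rw [hlZ] at hopt hcut ⊢
  rw [hlR] at hcut
  have hRK : ((k * l : ℕ) : ℤ) + s ≤ ((k + s : ℕ) : ℤ) * l := by
    push_cast
    have : (s : ℤ) ≤ s * l := le_mul_of_one_le_right (by positivity) (by exact_mod_cast hl1)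
    linarith
  have hmain : ∀ W, W = U ∨ W = Uᶜ → 2 * cubeCount W c ((k * l : ℕ) : ℤ) ≤ l ^ d →
      ∀ v ∈ cube c (l : ℤ), v ∉ W := by
    intro W hWU hW v hv
    have hdec := eq_zero_of_dyadic_decay (cubeCount W c) (cubeCount_mono W c) d C (2 * s)
      (Nat.succ_pos _) (((k + s : ℕ) : ℤ) * l - s) ?_ j ((k * l : ℕ) : ℤ) (by linarith) hW
    · refine cubeCount_eq_zero hdec (cube_mono c (le_of_eq ?_) hv)
      rw [hk, hK₁, hlZ]
      push_cast
      ring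
    · intro r hr q hq hWr
      have h1 := cubeCount_sub_le hs W c r q hq hWr
      have h2 := hopt W hWU (r + s) (by linarith)
      have hmono1 := cubeCount_mono W c (show r ≤ r + s by omega)
      have hmono2 := cubeCount_mono W c (show r ≤ r + (2 * s : ℕ) by push_cast; omega)
      have h3 : r + s + s = r + (2 * s : ℕ) := by push_cast; ring
      rw [h3] at h2
      have h4 : ((Λ.cutEdges W (cube c (r + s))).card : ℝ) ≤
          B / a * ((cubeCount W c (r + (2 * s : ℕ)) : ℝ) - cubeCount W c r) := by
        have h5 : (cubeCount W c r : ℝ) ≤ cubeCount W c (r + s) := by exact_mod_cast hmono1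
        rw [div_mul_eq_mul_div, le_div_iff₀ ha, mul_comm _ a]
        refine h2.trans (mul_le_mul_of_nonneg_left ?_ hB)
        linarith
      have h6 : (cubeCount W c (r - q) : ℝ) ≤
          C * q * ((cubeCount W c (r + (2 * s : ℕ)) : ℝ) - cubeCount W c r) := by
        have h7 : (0 : ℝ) ≤ (cubeCount W c (r + (2 * s : ℕ)) : ℝ) - cubeCount W c r := by
          rw [sub_nonneg]
          exact_mod_cast hmono2
        calc (cubeCount W c (r - q) : ℝ) ≤
              8 * (d + 1) * s * q * (Λ.cutEdges W (cube c (r + s))).card := by exact_mod_cast h1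
          _ ≤ 8 * (d + 1) * s * q *
              (B / a * ((cubeCount W c (r + (2 * s : ℕ)) : ℝ) - cubeCount W c r)) := by gcongr
          _ = (8 * (d + 1) * s * (B / a)) * q *
              ((cubeCount W c (r + (2 * s : ℕ)) : ℝ) - cubeCount W c r) := by ring
          _ ≤ _ := by gcongr
      rw [← Nat.cast_sub hmono2] at h6
      exact_mod_cast h6
  have hiso := cubeCount_mul_cubeCount_compl_le hs U c (k * l)
  have hsmall : 2 * cubeCount U c ((k * l : ℕ) : ℤ) ≤ l ^ d ∨
      2 * cubeCount Uᶜ c ((k * l : ℕ) : ℤ) ≤ l ^ d := by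
    by_contra! hcon
    have h1 : (l : ℝ) ^ d * (l : ℝ) ^ d <
        4 * ((cubeCount U c ((k * l : ℕ) : ℤ) : ℝ) * cubeCount Uᶜ c ((k * l : ℕ) : ℤ)) := by
      have h2 : (l : ℝ) ^ d < 2 * cubeCount U c ((k * l : ℕ) : ℤ) := by exact_mod_cast hcon.1
      have h3 : (l : ℝ) ^ d < 2 * cubeCount Uᶜ c ((k * l : ℕ) : ℤ) := by exact_mod_cast hcon.2
      have := mul_lt_mul'' h2 h3 (by positivity) (by positivity)
      linarith
    have h4 : ((cubeCount U c ((k * l : ℕ) : ℤ) : ℝ) * cubeCount Uᶜ c ((k * l : ℕ) : ℤ)) ≤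
        C' * (l : ℝ) ^ d *
          ((Λ.cutEdges U (cube c (((k + s : ℕ) : ℤ) * l))).card * (l : ℝ)) := by
      have := hiso.trans (isoperimetric_factor_le k d l s hl1 _ _
        (Finset.card_le_card (Λ.cutEdges_mono U (cube_mono c hRK))))
      exact_mod_cast this
    have h5 : C' * (l : ℝ) ^ d *
          ((Λ.cutEdges U (cube c (((k + s : ℕ) : ℤ) * l))).card * (l : ℝ)) ≤
        C' * (l : ℝ) ^ d * (1 / (4 * C' + 1) * (l : ℝ) ^ d) :=
      mul_le_mul_of_nonneg_left hcut (by positivity)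
    have h6 : 4 * (C' * (l : ℝ) ^ d * (1 / (4 * C' + 1) * (l : ℝ) ^ d)) ≤
        (l : ℝ) ^ d * (l : ℝ) ^ d := by
      have h7 : 4 * (C' : ℝ) * (1 / (4 * C' + 1)) ≤ 1 := by
        rw [mul_one_div, div_le_one (by positivity)]
        linarith
      calc 4 * (C' * (l : ℝ) ^ d * (1 / (4 * C' + 1) * (l : ℝ) ^ d))
          = (4 * (C' : ℝ) * (1 / (4 * C' + 1))) * ((l : ℝ) ^ d * (l : ℝ) ^ d) := by ring
        _ ≤ 1 * ((l : ℝ) ^ d * (l : ℝ) ^ d) := by gcongr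
        _ = _ := one_mul _
    linarith
  rcases hsmall with h | h
  · exact Or.inr (hmain U (Or.inl rfl) h)
  · refine Or.inl fun v hv => ?_
    have := hmain Uᶜ (Or.inr rfl) h v hv
    simpa using this

/-- A set without cut edges in a cube is trivial in a slightly smaller cube. -/
theorem forall_mem_or_forall_notMem_of_cutEdges_eq_empty {s : ℕ} (hs : Λ.IsRange s)
    (U : Set (LVertex d)) (c : Fin d → ℤ) (r : ℕ) (h : Λ.cutEdges U (cube c (r + s)) = ∅) :
    (∀ v ∈ cube c (r : ℤ), v ∈ U) ∨ ∀ v ∈ cube c (r : ℤ), v ∉ U := by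
  have hiso := cubeCount_mul_cubeCount_compl_le hs U c r
  rw [h, Finset.card_empty, mul_zero, zero_mul] at hiso
  rcases Nat.mul_eq_zero.1 (Nat.eq_zero_of_le_zero hiso) with h | h
  · exact Or.inr fun v hv => cubeCount_eq_zero h hv
  · refine Or.inl fun v hv => ?_
    have := cubeCount_eq_zero h hv
    simpa using this

end DimerLattice

/-! ### Depth and extension from the collar -/

section Depth

variable {E : Type*} [NormedAddCommGroup E]

open Classical in
/-- The distance to the frontier of `R` for points of `R`, and zero outside `R`. -/
noncomputable def depth (R : Set E) (x : E) : ℝ :=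
  if x ∈ R then Metric.infDist x (frontier R) else 0

theorem depth_nonneg (R : Set E) (x : E) : 0 ≤ depth R x := by
  unfold depth
  split_ifs
  exacts [Metric.infDist_nonneg, le_rfl]

theorem depth_le_infDist (R : Set E) (x : E) : depth R x ≤ Metric.infDist x (frontier R) := by
  unfold depth
  split_ifs
  exacts [le_rfl, Metric.infDist_nonneg]

theorem depth_le_dist (R : Set E) (x : E) {y : E} (hy : y ∈ frontier R) :
    depth R x ≤ dist x y :=
  (depth_le_infDist R x).trans (Metric.infDist_le_dist_of_mem hy)

theorem mem_of_depth_pos {R : Set E} {x : E} (h : 0 < depth R x) : x ∈ R := by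
  by_contra hx
  simp [depth, hx] at h

theorem depth_of_mem {R : Set E} {x : E} (h : x ∈ R) :
    depth R x = Metric.infDist x (frontier R) := if_pos h

/-- Off the frontier the space is the union of two disjoint open sets, `interior R` and the
complement of `closure R`. -/
theorem subset_interior_of_disjoint_frontier {R t : Set E} (ht : IsPreconnected t)
    (hd : Disjoint t (frontier R)) (hne : (t ∩ R).Nonempty) : t ⊆ interior R := by
  have hint : ∀ x ∈ t, x ∈ R → x ∈ interior R := by
    intro x hx hxR
    by_contra h
    exact Set.disjoint_left.1 hd hx ⟨subset_closure hxR, h⟩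
  refine ht.subset_left_of_subset_union (v := (closure R)ᶜ) isOpen_interior
    isClosed_closure.isOpen_compl ?_ ?_ ?_
  · exact Set.disjoint_left.2 fun x hx hx' => hx' (subset_closure (interior_subset hx))
  · intro x hx
    by_cases h : x ∈ closure R
    · left
      by_contra h'
      exact Set.disjoint_left.1 hd hx ⟨h, h'⟩
    · exact Or.inr h
  · obtain ⟨x, hx, hxR⟩ := hne
    exact ⟨x, hx, hint x hx hxR⟩

theorem ball_disjoint_frontier (R : Set E) (x : E) :
    Disjoint (Metric.ball x (Metric.infDist x (frontier R))) (frontier R) :=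
  Metric.disjoint_ball_infDist

theorem IsPreconnected.eq_of_forall_exists_int {s : Set E} (hs : IsPreconnected s) {f : E → ℝ}
    (hf : ContinuousOn f s) (hint : ∀ x ∈ s, ∃ k : ℤ, f x = k) {x y : E} (hx : x ∈ s)
    (hy : y ∈ s) : f x = f y := by
  refine hs.constant_of_mapsTo (T := Set.range ((↑) : ℤ → ℝ)) ?_ hf (fun z hz => ?_) hx hy
  · exact Int.isClosedEmbedding_coe_real.isEmbedding.isDiscrete_range
  · obtain ⟨k, hk⟩ := hint z hz
    exact ⟨k, hk.symm⟩

/-- The product of a bounded locally constant function on an open subset and a function vanishing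
on the rest is continuous. -/
theorem continuousOn_ite_mul {S O : Set E} [DecidablePred (· ∈ S)] (hS : IsOpen S) {g θ : E → ℝ}
    (hg : ∀ x ∈ S, ∀ᶠ y in 𝓝 x, g y = g x) (hb : ∀ x, |g x| ≤ 1) (hθ : Continuous θ)
    (h0 : ∀ x ∈ O, x ∉ S → θ x = 0) :
    ContinuousOn (fun x => if x ∈ S then g x * θ x else 0) O := by
  intro x hx
  refine ContinuousAt.continuousWithinAt ?_
  by_cases hxS : x ∈ S
  · have h1 : (fun y => g x * θ y) =ᶠ[𝓝 x] fun y => if y ∈ S then g y * θ y else 0 := by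
      filter_upwards [hg x hxS, hS.mem_nhds hxS] with y hy hyS
      rw [if_pos hyS, hy]
    exact ContinuousAt.congr (by fun_prop) h1
  · rw [ContinuousAt, if_neg hxS]
    have h1 : Tendsto (fun y => |θ y|) (𝓝 x) (𝓝 0) := by
      have := (hθ.abs).tendsto x
      rwa [h0 x hx hxS, abs_zero] at this
    refine squeeze_zero_norm (fun y => ?_) h1
    split_ifs
    · rw [Real.norm_eq_abs, abs_mul]
      exact mul_le_of_le_one_left (abs_nonneg _) (hb y)
    · simp

variable [NormedSpace ℝ E]

theorem ball_depth_subset_interior (R : Set E) (x : E) :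
    Metric.ball x (depth R x) ⊆ interior R := by
  by_cases h : 0 < depth R x
  · have hx := mem_of_depth_pos h
    rw [depth_of_mem hx] at h ⊢
    exact subset_interior_of_disjoint_frontier (convex_ball _ _).isPreconnected
      (ball_disjoint_frontier R x) ⟨x, Metric.mem_ball_self h, hx⟩
  · rw [Metric.ball_eq_empty.2 (not_lt.1 h)]
    exact Set.empty_subset _

/-- If y is closer to x than the depth of x, then y lies in R and both depths are distances to the
frontier. Otherwise the distance alone suffices. So extension by zero keeps the depth 1-Lipschitz.
-/
theorem depth_le_depth_add_dist (R : Set E) (x y : E) : depth R x ≤ depth R y + dist x y := by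
  by_cases h : dist x y < depth R x
  · have hx : x ∈ R := mem_of_depth_pos (dist_nonneg.trans_lt h)
    have hy : y ∈ R := interior_subset (ball_depth_subset_interior R x (by
      rwa [Metric.mem_ball, dist_comm]))
    rw [depth_of_mem hx, depth_of_mem hy]
    exact Metric.infDist_le_infDist_add_dist
  · have := depth_nonneg R y
    linarith

theorem continuous_depth (R : Set E) : Continuous (depth R) := by
  refine (LipschitzWith.of_le_add fun x y => ?_).continuous
  exact depth_le_depth_add_dist R x y

/-- The part of `R` of small depth, together with the outside of `R`, is connected when the
frontier of `R` is connected. -/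
theorem isPreconnected_depth_lt [ProperSpace E] {R : Set E} (hconn : IsConnected (frontier R))
    {κ : ℝ} (hκ : 0 < κ) : IsPreconnected {x | depth R x < κ} := by
  -- Each point is joined to the connected frontier by a segment of small depth. A point of R goes
  -- to a frontier point within κ; a point outside R goes to a nearest frontier point, along which
  -- the depth vanishes.
  have hseg : ∀ x, depth R x < κ → ∃ y ∈ frontier R, segment ℝ x y ⊆ {x | depth R x < κ} := by
    intro x hx
    by_cases hxR : x ∈ R
    · rw [depth_of_mem hxR, Metric.infDist_lt_iff hconn.nonempty] at hx
      obtain ⟨y, hy, hxy⟩ := hx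
      refine ⟨y, hy, fun z hz => ?_⟩
      have hz' : z ∈ Metric.ball y κ := (convex_ball y κ).segment_subset
        (Metric.mem_ball.2 hxy) (Metric.mem_ball_self hκ) hz
      exact (depth_le_dist R z hy).trans_lt hz'
    · obtain ⟨y, hy, hxy⟩ := isClosed_frontier.exists_infDist_eq_dist hconn.nonempty x
      refine ⟨y, hy, fun z hz => ?_⟩
      suffices h0 : depth R z = 0 from h0.trans_lt hκ
      rcases eq_or_ne x y with rfl | hne
      · rw [segment_same, Set.mem_singleton_iff] at hz
        rw [hz]
        exact if_neg hxR
      · have hball : ∀ p ∈ Metric.ball x (dist x y), depth R p = 0 := by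
          intro p hp
          refine if_neg fun hpR => hxR ?_
          rw [← hxy] at hp
          exact interior_subset (subset_interior_of_disjoint_frontier
            (convex_ball _ _).isPreconnected (ball_disjoint_frontier R x) ⟨p, hp, hpR⟩
            (Metric.mem_ball_self (by rw [hxy]; exact dist_pos.2 hne)))
        have hcl : closure (Metric.ball x (dist x y)) ⊆ {p | depth R p = 0} :=
          closure_minimal hball (isClosed_eq (continuous_depth R) continuous_const)
        rw [closure_ball x (dist_pos.2 hne).ne'] at hcl
        refine hcl ((convex_closedBall x (dist x y)).segment_subset
          (Metric.mem_closedBall_self dist_nonneg) ?_ hz)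
        rw [Metric.mem_closedBall, dist_comm]
  obtain ⟨p, hp⟩ := hconn.nonempty
  have hfr : frontier R ⊆ {x | depth R x < κ} := fun x hx =>
    (depth_le_dist R x hx).trans_lt (by rwa [dist_self])
  refine isPreconnected_of_forall p fun x hx => ?_
  obtain ⟨y, hy, hxy⟩ := hseg x hx
  refine ⟨frontier R ∪ segment ℝ x y, Set.union_subset hfr hxy, Or.inl hp,
    Or.inr (left_mem_segment ℝ x y), ?_⟩
  exact hconn.isPreconnected.union y hy (right_mem_segment ℝ x y)
    (convex_segment x y).isPreconnected

open Classical in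
/-- A locally constant function on a collar of a compact set with connected frontier extends to
the whole inner part of the set. -/
theorem exists_extension_of_locally_constant [FiniteDimensional ℝ E] {R : Set E}
    (hconn : IsConnected (frontier R)) {κ : ℝ} (hκ : 0 < κ) (g : E → ℝ)
    (hg : ∀ x, κ < depth R x → depth R x < 2 * κ → ∀ᶠ y in 𝓝 x, g y = g x)
    (hg01 : ∀ x, g x = 0 ∨ g x = 1) :
    ∃ G : E → ℝ, (∀ x, κ < depth R x → depth R x < 2 * κ → G x = g x) ∧
      ∀ x y, (∀ z ∈ segment ℝ x y, κ < depth R z) → G x = G y := by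
  have : ProperSpace E := FiniteDimensional.proper ℝ E
  set S : Set E := {x | κ < depth R x ∧ depth R x < 2 * κ} with hS
  have hdc := continuous_depth R
  have hSo : IsOpen S := (isOpen_lt continuous_const hdc).inter (isOpen_lt hdc continuous_const)
  set O₁ : Set E := {x | κ < depth R x} with hO₁
  set O₂ : Set E := {x | depth R x < 2 * κ} with hO₂
  have hO₁o : IsOpen O₁ := isOpen_lt continuous_const hdc
  have hO₂o : IsOpen O₂ := isOpen_lt hdc continuous_const
  have hcover : ∀ x, x ∈ O₁ ∨ x ∈ O₂ := by
    intro x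
    rcases lt_or_ge κ (depth R x) with h | h
    · exact Or.inl h
    · exact Or.inr (lt_of_le_of_lt h (by linarith))
  -- A Mayer–Vietoris argument. On the collar g = gχ - g(χ - 1), where the first term extends
  -- continuously by zero to `O₂` and the second to `O₁`. As g is an integer, the two phases
  -- exp(2πi·) agree and glue to a circle-valued map on the whole space.
  let χ : E → ℝ := fun x => max 0 (min 1 ((depth R x - κ) / κ))
  have hχ : Continuous χ := by fun_prop
  have hχ1 : ∀ x ∈ O₁, x ∉ S → χ x - 1 = 0 := by
    intro x hx hxS
    have h2 : 2 * κ ≤ depth R x := by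
      by_contra! h
      exact hxS ⟨hx, h⟩
    have h3 : 1 ≤ (depth R x - κ) / κ := by
      rw [le_div_iff₀ hκ]
      linarith
    simp [χ, min_eq_left h3]
  have hχ0 : ∀ x ∈ O₂, x ∉ S → χ x = 0 := by
    intro x hx hxS
    have h2 : depth R x ≤ κ := by
      by_contra! h
      exact hxS ⟨h, hx⟩
    have h3 : (depth R x - κ) / κ ≤ 0 := div_nonpos_of_nonpos_of_nonneg (by linarith) hκ.le
    exact max_eq_left ((min_le_right _ _).trans h3)
  have hgS : ∀ x ∈ S, ∀ᶠ y in 𝓝 x, g y = g x := fun x hx => hg x hx.1 hx.2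
  have hgb : ∀ x, |g x| ≤ 1 := by
    intro x
    rcases hg01 x with h | h <;> simp [h]
  let p : E → ℝ := fun x => if x ∈ S then g x * (χ x - 1) else 0
  let q : E → ℝ := fun x => if x ∈ S then g x * χ x else 0
  have hp : ContinuousOn p O₁ :=
    continuousOn_ite_mul hSo hgS hgb (θ := fun x => χ x - 1) (hχ.sub continuous_const) hχ1
  have hq : ContinuousOn q O₂ := continuousOn_ite_mul hSo hgS hgb hχ hχ0
  have hgint : ∀ x, ∃ k : ℤ, g x = k := by
    intro x
    rcases hg01 x with h | h
    · exact ⟨0, by simp [h]⟩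
    · exact ⟨1, by simp [h]⟩
  have hqp : ∀ x, ∃ k : ℤ, q x = p x + k := by
    intro x
    by_cases hx : x ∈ S
    · obtain ⟨k, hk⟩ := hgint x
      refine ⟨k, ?_⟩
      simp only [p, q, if_pos hx]
      rw [← hk]
      ring
    · exact ⟨0, by simp [p, q, hx]⟩
  have hexp : ∀ x, Circle.exp (2 * Real.pi * q x) = Circle.exp (2 * Real.pi * p x) := by
    intro x
    obtain ⟨k, hk⟩ := hqp x
    rw [hk, mul_add, Circle.exp_add, Circle.exp_two_pi_mul_int, mul_one]
  have hf : Continuous fun x => Circle.exp (2 * Real.pi * q x) := by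
    rw [continuous_iff_continuousAt]
    intro x
    rcases hcover x with hx | hx
    · simp only [hexp]
      have : ContinuousAt p x := hp.continuousAt (hO₁o.mem_nhds hx)
      exact Circle.exp.continuous.continuousAt.comp (continuousAt_const.mul this)
    · have : ContinuousAt q x := hq.continuousAt (hO₂o.mem_nhds hx)
      exact Circle.exp.continuous.continuousAt.comp (continuousAt_const.mul this)
  -- Simple connectedness lifts the circle-valued map to a real function F. Then F/2π differs from q
  -- and from p by integers everywhere.
  have hcontr : SimplyConnectedSpace E := inferInstance
  obtain ⟨F, ⟨-, hF⟩, -⟩ := Circle.isCoveringMap_exp.existsUnique_continuousMap_lifts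
    (⟨_, hf⟩ : C(E, Circle)) 0 (2 * Real.pi * q 0) rfl
  have hFq : ∀ x, ∃ k : ℤ, F x / (2 * Real.pi) - q x = k := by
    intro x
    have h1 : Circle.exp (F x) = Circle.exp (2 * Real.pi * q x) := congrFun hF x
    have h2 : Circle.exp (F x - 2 * Real.pi * q x) = 1 := by
      rw [Circle.exp_sub, h1, div_self']
    obtain ⟨k, hk⟩ := Circle.exp_eq_one.1 h2
    refine ⟨k, ?_⟩
    have hpi := Real.pi_pos
    field_simp
    linarith
  have hFp : ∀ x, ∃ k : ℤ, F x / (2 * Real.pi) - p x = k := by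
    intro x
    obtain ⟨k, hk⟩ := hFq x
    obtain ⟨m, hm⟩ := hqp x
    refine ⟨k + m, ?_⟩
    push_cast
    linarith
  have hFc : Continuous fun x => F x / (2 * Real.pi) := F.continuous.div_const _
  obtain ⟨x₀, hx₀⟩ := hconn.nonempty
  have hx₀' : x₀ ∈ O₂ := by
    have := depth_le_dist R x₀ hx₀
    rw [dist_self] at this
    show depth R x₀ < 2 * κ
    linarith
  -- Connectedness of the frontier is used here: `O₂` is connected, so the integer F/2π - q is
  -- constant on it. Subtracting this constant from F/2π - p leaves q - p = g on the collar.
  have hconst : ∀ x ∈ O₂, F x / (2 * Real.pi) - q x = F x₀ / (2 * Real.pi) - q x₀ :=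
    fun x hx => (isPreconnected_depth_lt hconn (by linarith)).eq_of_forall_exists_int
      (hFc.continuousOn.sub hq) (fun x _ => hFq x) hx hx₀'
  refine ⟨fun x => F x / (2 * Real.pi) - p x - (F x₀ / (2 * Real.pi) - q x₀), ?_, ?_⟩
  · intro x hx1 hx2
    have hxS : x ∈ S := ⟨hx1, hx2⟩
    have h1 := hconst x hx2
    simp only [p, q, if_pos hxS] at h1 ⊢
    linarith
  · intro x y hxy
    have := (convex_segment x y).isPreconnected.eq_of_forall_exists_int
      ((hFc.continuousOn.sub hp).mono hxy) (fun x _ => hFp x) (left_mem_segment ℝ x y)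
      (right_mem_segment ℝ x y)
    exact congrArg (· - (F x₀ / (2 * Real.pi) - q x₀)) this

end Depth

/-! ### Null frontier and counting lattice points -/

/-- C^1 images of a (d - 1)-cube have Hausdorff dimension at most d - 1. The assumption 1 ≤ d makes
the natural subtraction strict. -/
theorem volume_frontier_eq_zero {d : ℕ} (hd : 1 ≤ d) {R : Set (EuclideanSpace ℝ (Fin d))}
    (h : HasPiecewiseSmoothBoundary R) : volume (frontier R) = 0 := by
  obtain ⟨k, φ, hφ, hR⟩ := h
  have hac : (volume : Measure (EuclideanSpace ℝ (Fin d))) ≪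
      Measure.hausdorffMeasure (Module.finrank ℝ (EuclideanSpace ℝ (Fin d)) : ℝ) :=
    Measure.absolutelyContinuous_isAddHaarMeasure _ _
  have hdim : dimH (frontier R) ≤ ((d - 1 : ℕ) : ENNReal) := by
    rw [hR, dimH_iUnion]
    refine iSup_le fun i => ?_
    have h1 := (hφ i).dimH_image_le (convex_Icc (0 : Fin (d - 1) → ℝ) 1) subset_rfl
    refine h1.trans ((dimH_mono (Set.subset_univ _)).trans ?_)
    rw [Real.dimH_univ_pi_fin]
  have hac' : (volume : Measure (EuclideanSpace ℝ (Fin d))) ≪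
      Measure.hausdorffMeasure (((d : NNReal) : ℝ)) := by
    simpa using hac
  refine measure_zero_of_dimH_lt hac' (hdim.trans_lt ?_)
  have : d - 1 < d := by omega
  exact_mod_cast this

namespace DimerLattice

variable {d D : ℕ} (Λ : DimerLattice d D)

/-- Position of a vertex in the rescaled lattice. -/
noncomputable def scaledPos (n : ℕ) (v : LVertex d) : EuclideanSpace ℝ (Fin d) :=
  (n : ℝ)⁻¹ • Λ.pos v

/-- `C` bounds the distortion of the linear map defining the lattice. -/
def IsDistortion (C : ℝ) : Prop :=
  0 < C ∧ (∀ y, ‖Λ.toSpace y‖ ≤ C * ‖y‖) ∧ ∀ y, ‖y‖ ≤ C * ‖Λ.toSpace y‖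

theorem exists_isDistortion : ∃ C, Λ.IsDistortion C := by
  let T := Λ.toSpace.toContinuousLinearEquiv
  refine ⟨max 1 (max ‖(T : (Fin d → ℝ) →L[ℝ] EuclideanSpace ℝ (Fin d))‖
    ‖(T.symm : EuclideanSpace ℝ (Fin d) →L[ℝ] (Fin d → ℝ))‖), by positivity, ?_, ?_⟩
  · intro y
    refine ((T : (Fin d → ℝ) →L[ℝ] EuclideanSpace ℝ (Fin d)).le_opNorm y).trans ?_
    gcongr
    exact (le_max_left _ _).trans (le_max_right _ _)
  · intro y
    have := (T.symm : EuclideanSpace ℝ (Fin d) →L[ℝ] (Fin d → ℝ)).le_opNorm (T y)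
    simp only [ContinuousLinearEquiv.coe_coe, ContinuousLinearEquiv.symm_apply_apply] at this
    refine this.trans ?_
    have h2 : T y = Λ.toSpace y := rfl
    rw [h2]
    gcongr
    exact (le_max_right _ _).trans (le_max_right _ _)

/-- The offset of a vertex from the white vertex with the same integer coordinates. -/
def offset : LVertex d → Fin d → ℝ := Sum.elim (fun _ _ => 0) fun _ => Λ.v₀

theorem pos_eq (v : LVertex d) : Λ.pos v = Λ.toSpace fun j => (coord v j : ℝ) + Λ.offset v j := by
  rcases v with w | b
  · simp [pos, coord, offset]
  · simp [pos, coord, offset]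

theorem abs_offset_sub_le (u v : LVertex d) (j : Fin d) :
    |Λ.offset u j - Λ.offset v j| ≤ 1 := by
  have h := Λ.v₀_mem j
  rw [abs_le]
  rcases u with u | u <;> rcases v with v | v <;> simp only [offset, Sum.elim_inl, Sum.elim_inr]
    <;> constructor <;> linarith [h.1, h.2]

variable {Λ}

theorem norm_pos_sub_le {C : ℝ} (hC : Λ.IsDistortion C) {u v : LVertex d} {r : ℝ} (hr : 0 ≤ r)
    (h : ∀ j, |(coord u j : ℝ) - coord v j| ≤ r) : ‖Λ.pos u - Λ.pos v‖ ≤ C * (r + 1) := by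
  rw [pos_eq, pos_eq, ← map_sub]
  refine (hC.2.1 _).trans (mul_le_mul_of_nonneg_left ?_ hC.1.le)
  rw [pi_norm_le_iff_of_nonneg (by linarith)]
  intro j
  rw [Pi.sub_apply, Real.norm_eq_abs, add_sub_add_comm]
  exact (abs_add_le _ _).trans (add_le_add (h j) (Λ.abs_offset_sub_le u v j))

theorem abs_coord_sub_le {C : ℝ} (hC : Λ.IsDistortion C) (u v : LVertex d) (j : Fin d) :
    |(coord u j : ℝ) - coord v j| ≤ C * ‖Λ.pos u - Λ.pos v‖ + 1 := by
  have h1 : |(coord u j : ℝ) + Λ.offset u j - (coord v j + Λ.offset v j)| ≤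
      C * ‖Λ.pos u - Λ.pos v‖ := by
    rw [pos_eq, pos_eq, ← map_sub]
    refine le_trans ?_ (hC.2.2 _)
    exact norm_le_pi_norm (fun j => (coord u j : ℝ) + Λ.offset u j -
      (coord v j + Λ.offset v j)) j
  have h2 := Λ.abs_offset_sub_le v u j
  have h3 : (coord u j : ℝ) - coord v j = ((coord u j : ℝ) + Λ.offset u j -
      (coord v j + Λ.offset v j)) + (Λ.offset v j - Λ.offset u j) := by ring
  rw [h3]
  exact (abs_add_le _ _).trans (add_le_add h1 h2)

theorem one_le_mul_norm_pos_sub {C : ℝ} (hC : Λ.IsDistortion C) {u v : LVertex d}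
    (h : u.isLeft = v.isLeft) (hne : u ≠ v) : 1 ≤ C * ‖Λ.pos u - Λ.pos v‖ := by
  have hoff : Λ.offset u = Λ.offset v := by
    rcases u with u | u <;> rcases v with v | v <;> simp_all [offset]
  obtain ⟨j, hj⟩ : ∃ j, coord u j ≠ coord v j := by
    by_contra! hcon
    exact hne (eq_of_coord_eq h (funext hcon))
  have h1 : (1 : ℝ) ≤ |(coord u j : ℝ) - coord v j| := by
    have : (1 : ℤ) ≤ |coord u j - coord v j| := Int.one_le_abs (sub_ne_zero.2 hj)
    exact_mod_cast this
  refine h1.trans ?_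
  rw [pos_eq, pos_eq, ← map_sub, hoff]
  refine le_trans ?_ (hC.2.2 _)
  have := norm_le_pi_norm ((fun j => (coord u j : ℝ) + Λ.offset v j) -
    fun j => (coord v j : ℝ) + Λ.offset v j) j
  simpa using this

theorem exists_norm_pos_sub_le {C : ℝ} (hC : Λ.IsDistortion C) (x : EuclideanSpace ℝ (Fin d)) :
    ∃ z : Fin d → ℤ, ‖Λ.pos (Sum.inl z) - x‖ ≤ C := by
  refine ⟨fun j => ⌊Λ.toSpace.symm x j⌋, ?_⟩
  have h1 : Λ.pos (Sum.inl fun j => ⌊Λ.toSpace.symm x j⌋) - x =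
      Λ.toSpace ((fun j => (⌊Λ.toSpace.symm x j⌋ : ℝ)) - Λ.toSpace.symm x) := by
    rw [map_sub, LinearEquiv.apply_symm_apply]
    rfl
  rw [h1]
  refine (hC.2.1 _).trans (mul_le_of_le_one_right hC.1.le ?_)
  rw [pi_norm_le_iff_of_nonneg zero_le_one]
  intro j
  rw [Pi.sub_apply, Real.norm_eq_abs, abs_sub_comm]
  rw [abs_of_nonneg (sub_nonneg.2 (Int.floor_le _))]
  linarith [Int.lt_floor_add_one (Λ.toSpace.symm x j)]

theorem dist_scaledPos {n : ℕ} (u v : LVertex d) :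
    dist (Λ.scaledPos n u) (Λ.scaledPos n v) = (n : ℝ)⁻¹ * ‖Λ.pos u - Λ.pos v‖ := by
  rw [dist_eq_norm, scaledPos, scaledPos, ← smul_sub, norm_smul, Real.norm_eq_abs,
    abs_of_nonneg (by positivity)]

/-- A compact null set is close to few lattice points. -/
theorem exists_card_le_of_volume_eq_zero {X : Set (EuclideanSpace ℝ (Fin d))} (hX : IsCompact X)
    (h0 : volume X = 0) {ε : ℝ} (hε : 0 < ε) :
    ∃ η > 0, ∀ᶠ n : ℕ in atTop, ∀ A : Finset (LVertex d),
      (∀ v ∈ A, ∃ x ∈ X, dist (Λ.scaledPos n v) x < η) → (A.card : ℝ) ≤ ε * (n : ℝ) ^ d := by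
  obtain ⟨C, hC⟩ := Λ.exists_isDistortion
  have hC0 := hC.1
  set ρ : ℝ := (2 * C)⁻¹ with hρ
  have hρ0 : 0 < ρ := by positivity
  set m : ENNReal := volume (Metric.ball (0 : EuclideanSpace ℝ (Fin d)) 1) with hm
  have hm0 : 0 < m := Metric.measure_ball_pos _ _ one_pos
  have hmt : m ≠ ⊤ := measure_ball_lt_top.ne
  have hpos : 0 < ENNReal.ofReal (ε / 2 * ρ ^ d) * m :=
    ENNReal.mul_pos (ENNReal.ofReal_pos.2 (by positivity)).ne' hm0.ne'
  have hlim := tendsto_measure_cthickening_of_isCompact (μ := volume) hX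
  rw [h0] at hlim
  obtain ⟨θ, hθ0, hθ⟩ : ∃ θ > 0, volume (Metric.cthickening θ X) <
      ENNReal.ofReal (ε / 2 * ρ ^ d) * m := by
    have h1 := hlim.eventually (gt_mem_nhds hpos)
    obtain ⟨θ, hθ⟩ := ((h1.filter_mono nhdsWithin_le_nhds).and
      (self_mem_nhdsWithin (a := (0 : ℝ)) (s := Set.Ioi 0))).exists
    exact ⟨θ, hθ.2, hθ.1⟩
  refine ⟨θ / 2, by positivity, ?_⟩
  have hn1 : ∀ᶠ n : ℕ in atTop, ρ / n < θ / 2 :=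
    (tendsto_const_div_atTop_nhds_zero_nat ρ).eventually (gt_mem_nhds (by positivity))
  filter_upwards [hn1, eventually_gt_atTop 0] with n hn hn0 A hA
  have hnR : (0 : ℝ) < n := by exact_mod_cast hn0
  -- Vertices of one colour are uniformly separated, so balls of radius ρ/n around them are
  -- disjoint; they lie in a thickening of X of small volume. Comparing volumes bounds each colour
  -- separately.
  have hcol : ∀ A' ⊆ A, (∀ u ∈ A', ∀ v ∈ A', u.isLeft = v.isLeft) →
      (A'.card : ℝ) ≤ ε / 2 * (n : ℝ) ^ d := by
    intro A' hA' hcolour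
    have hdisj : (A' : Set (LVertex d)).PairwiseDisjoint
        fun v => Metric.ball (Λ.scaledPos n v) (ρ / n) := by
      intro u hu v hv huv
      refine Metric.ball_disjoint_ball ?_
      have h1 := one_le_mul_norm_pos_sub hC (hcolour u hu v hv) huv
      rw [dist_scaledPos, hρ, ← add_div, ← div_eq_inv_mul]
      gcongr
      have : (2 * C)⁻¹ + (2 * C)⁻¹ = C⁻¹ := by field_simp; norm_num
      rw [this, inv_le_iff_one_le_mul₀ hC0, mul_comm]
      exact h1
    have hsub : ⋃ v ∈ A', Metric.ball (Λ.scaledPos n v) (ρ / n) ⊆ Metric.cthickening θ X := by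
      refine Set.iUnion₂_subset fun v hv y hy => ?_
      obtain ⟨x, hx, hvx⟩ := hA v (hA' hv)
      refine Metric.mem_cthickening_of_dist_le y x θ X hx ?_
      have := dist_triangle y (Λ.scaledPos n v) x
      rw [Metric.mem_ball] at hy
      linarith
    have hvol : volume (⋃ v ∈ A', Metric.ball (Λ.scaledPos n v) (ρ / n)) =
        A'.card * (ENNReal.ofReal ((ρ / n) ^ d) * m) := by
      rw [measure_biUnion_finset hdisj fun _ _ => measurableSet_ball]
      rw [Finset.sum_congr rfl fun v _ => Measure.addHaar_ball_of_pos volume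
        (Λ.scaledPos n v) (show 0 < ρ / n by positivity)]
      simp [hm]
    have h2 : A'.card * (ENNReal.ofReal ((ρ / n) ^ d) * m) ≤
        ENNReal.ofReal (ε / 2 * ρ ^ d) * m := by
      rw [← hvol]
      exact (measure_mono hsub).trans hθ.le
    rw [← mul_assoc, ENNReal.mul_le_mul_iff_left hm0.ne' hmt, ← ENNReal.ofReal_natCast,
      ← ENNReal.ofReal_mul (by positivity),
      ENNReal.ofReal_le_ofReal_iff (by positivity), div_pow, mul_div_assoc',
      div_le_iff₀ (by positivity)] at h2
    have h3 : (A'.card : ℝ) * ρ ^ d ≤ (ε / 2 * (n : ℝ) ^ d) * ρ ^ d := by linarith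
    exact le_of_mul_le_mul_right h3 (by positivity)
  have h1 := hcol (A.filter fun v => v.isLeft) (Finset.filter_subset _ _) (by
    intro u hu v hv
    rw [(Finset.mem_filter.1 hu).2, (Finset.mem_filter.1 hv).2])
  have h2 := hcol (A.filter fun v => ¬ v.isLeft) (Finset.filter_subset _ _) (by
    intro u hu v hv
    rw [Bool.eq_false_iff.2 (Finset.mem_filter.1 hu).2,
      Bool.eq_false_iff.2 (Finset.mem_filter.1 hv).2])
  have h3 := Finset.card_filter_add_card_filter_not (s := A) (fun v => v.isLeft = true)
  have h4 : (A.card : ℝ) = (A.filter fun v => v.isLeft).card +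
      (A.filter fun v => ¬ v.isLeft).card := by exact_mod_cast h3.symm
  rw [h4]
  linarith

theorem HausdorffApprox.eventually {S : ℕ → Set (LVertex d)} {X : Set (EuclideanSpace ℝ (Fin d))}
    (h : Λ.HausdorffApprox S X) {ε : ℝ} (hε : 0 < ε) :
    ∀ᶠ n in atTop, (∀ v ∈ S n, ∃ x ∈ X, dist (Λ.scaledPos n v) x < ε) ∧
      ∀ x ∈ X, ∃ v ∈ S n, dist (Λ.scaledPos n v) x < ε := by
  have h1 : ∀ᶠ n in atTop, Metric.hausdorffEDist (Λ.scaledPoints n (S n)) X < ENNReal.ofReal ε :=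
    Tendsto.eventually h (gt_mem_nhds (ENNReal.ofReal_pos.2 hε))
  filter_upwards [h1] with n hn
  constructor
  · intro v hv
    obtain ⟨x, hx, hvx⟩ := Metric.exists_edist_lt_of_hausdorffEDist_lt
      (Set.mem_image_of_mem _ hv) hn
    exact ⟨x, hx, edist_lt_ofReal.1 hvx⟩
  · intro x hx
    rw [Metric.hausdorffEDist_comm] at hn
    obtain ⟨y, ⟨v, hv, rfl⟩, hvx⟩ := Metric.exists_edist_lt_of_hausdorffEDist_lt hx hn
    refine ⟨v, hv, ?_⟩
    rw [dist_comm]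
    exact edist_lt_ofReal.1 hvx

end DimerLattice

/-! ### The effect of emptying or filling a cube -/

namespace DimerLattice

variable {d D : ℕ} {Λ : DimerLattice d D}

theorem mem_cutEdges {U : Set (LVertex d)} {Q : Finset (LVertex d)} {e : LEdge d D} :
    e ∈ Λ.cutEdges U Q ↔ (whiteEnd e ∈ Q ∧ Λ.blackEnd e ∈ Q) ∧
      ¬ (whiteEnd e ∈ U ↔ Λ.blackEnd e ∈ U) := by
  classical
  rw [cutEdges, Finset.mem_filter, mem_edgeFinset]
  rfl

open Classical in
/-- The edges in `G` between `Q` and vertices of `W` outside `Q`. -/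
noncomputable def crossingEdges (Λ : DimerLattice d D) (G : Finset (LEdge d D))
    (Q : Finset (LVertex d)) (W : Set (LVertex d)) : Finset (LEdge d D) :=
  G.filter fun e => (whiteEnd e ∈ Q ∧ Λ.blackEnd e ∉ Q ∧ Λ.blackEnd e ∈ W) ∨
    (Λ.blackEnd e ∈ Q ∧ whiteEnd e ∉ Q ∧ whiteEnd e ∈ W)

/-- The change of the cost of a cut when the cut is made trivial in `Q`. -/
theorem sum_cutCost_flip_le {S T Q : Finset (LVertex d)} {N : ℕ} {M' : LEdge d D → ℕ} {a : ℝ}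
    (hM' : Λ.IsDimerCover S N M') (ha : ∀ e ∈ Λ.edges S, a * N ≤ M' e)
    {U U' : Finset (LVertex d)} (hQ : Λ.cutEdges (U : Set (LVertex d)) Q ⊆ Λ.free S T) (p : Prop)
    (hoff : ∀ v, v ∉ Q → (v ∈ U' ↔ v ∈ U)) (hon : ∀ v ∈ Q, v ∈ U' ↔ p)
    {W : Set (LVertex d)} (hW : ∀ v, v ∈ W ↔ (v ∈ U ↔ ¬ p)) :
    (∑ e ∈ Λ.free S T, (Λ.cutCost N M' U' e : ℝ)) +
        a * N * (Λ.cutEdges (U : Set (LVertex d)) Q).card ≤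
      (∑ e ∈ Λ.free S T, (Λ.cutCost N M' U e : ℝ)) +
        2 * N * (Λ.crossingEdges (Λ.free S T) Q W).card := by
  classical
  have h1 : a * N * (Λ.cutEdges (U : Set (LVertex d)) Q).card =
      ∑ e ∈ Λ.free S T, if e ∈ Λ.cutEdges (U : Set (LVertex d)) Q then a * N else 0 := by
    rw [← Finset.sum_filter, Finset.filter_mem_eq_inter, Finset.inter_eq_right.2 hQ,
      Finset.sum_const, nsmul_eq_mul, mul_comm]
  have h2 : 2 * N * ((Λ.crossingEdges (Λ.free S T) Q W).card : ℝ) =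
      ∑ e ∈ Λ.free S T, if (whiteEnd e ∈ Q ∧ Λ.blackEnd e ∉ Q ∧ Λ.blackEnd e ∈ W) ∨
        (Λ.blackEnd e ∈ Q ∧ whiteEnd e ∉ Q ∧ whiteEnd e ∈ W) then (2 * N : ℝ) else 0 := by
    rw [← Finset.sum_filter, Finset.sum_const, nsmul_eq_mul, mul_comm]
    congr!
  rw [h1, h2, ← Finset.sum_add_distrib, ← Finset.sum_add_distrib]
  -- Inside Q every cut edge is saved, a gain of at least aN. An edge leaving Q can become cut, at
  -- cost at most 2N, only if its outer end disagrees with p, that is, lies in W. Edges outside Q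
  -- are unaffected.
  refine Finset.sum_le_sum fun e he => ?_
  have heS : e ∈ Λ.edges S := Λ.mem_edgeFinset.1 (Finset.mem_filter.1 he).1
  have hae := ha e heS
  have hMN : (M' e : ℝ) ≤ N := by exact_mod_cast hM'.le e
  have hM0 : (0 : ℝ) ≤ M' e := by positivity
  have hN0 : (0 : ℝ) ≤ N := by positivity
  simp only [mem_cutEdges, hW, cutCost, Finset.mem_coe]
  by_cases hw : whiteEnd e ∈ Q <;> by_cases hb : Λ.blackEnd e ∈ Q
  · have h3 := hon _ hw
    have h4 := hon _ hb
    by_cases hp : p <;> by_cases hwU : whiteEnd e ∈ U <;> by_cases hbU : Λ.blackEnd e ∈ U <;>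
      simp [hw, hb, h3, h4, hp, hwU, hbU] <;> linarith
  · have h3 := hon _ hw
    have h4 := hoff _ hb
    by_cases hp : p <;> by_cases hwU : whiteEnd e ∈ U <;> by_cases hbU : Λ.blackEnd e ∈ U <;>
      simp [hw, hb, h3, h4, hp, hwU, hbU] <;> linarith
  · have h3 := hoff _ hw
    have h4 := hon _ hb
    by_cases hp : p <;> by_cases hwU : whiteEnd e ∈ U <;> by_cases hbU : Λ.blackEnd e ∈ U <;>
      simp [hw, hb, h3, h4, hp, hwU, hbU] <;> linarith
  · have h3 := hoff _ hw
    have h4 := hoff _ hb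
    simp [hw, hb, h3, h4]

/-- Edges have extent at most s, so the outer end of a crossing edge is a vertex of W in the shell
of width s. The outer end and the type determine the edge. -/
theorem card_crossingEdges_le {s : ℕ} (hs : Λ.IsRange s) (G : Finset (LEdge d D))
    (c : Fin d → ℤ) (r : ℤ) (W : Set (LVertex d)) :
    ((Λ.crossingEdges G (cube c r) W).card : ℝ) ≤
      D * ((cubeCount W c (r + s) : ℝ) - cubeCount W c r) := by
  classical
  set A : Finset (LVertex d) := (cube c (r + s)).filter fun v => v ∈ W with hA
  set B : Finset (LVertex d) := (cube c r).filter fun v => v ∈ W with hB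
  have hBA : B ⊆ A := Finset.filter_subset_filter _ (cube_mono c (by omega))
  have hdiff : ((A \ B).card : ℝ) = (cubeCount W c (r + s) : ℝ) - cubeCount W c r := by
    rw [Finset.card_sdiff_of_subset hBA, Nat.cast_sub (Finset.card_le_card hBA)]
    unfold cubeCount
    congr!
  rw [← hdiff]
  have hnear : ∀ (e : LEdge d D) (j : Fin d),
      |coord (whiteEnd e) j - coord (Λ.blackEnd e) j| ≤ s := by
    intro e j
    have h : coord (whiteEnd e) j - coord (Λ.blackEnd e) j = -Λ.shift e.2 j := by
      simp [coord, whiteEnd, blackEnd]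
    rw [h, abs_neg]
    exact hs.1 _ _
  have hin : ∀ u v : LVertex d, (∀ j, |coord u j - coord v j| ≤ s) → u ∈ cube c r → v ∉ cube c r →
      v ∈ W → v ∈ A \ B := by
    intro u v huv hu hv hvW
    rw [Finset.mem_sdiff, hA, hB, Finset.mem_filter, Finset.mem_filter]
    refine ⟨⟨?_, hvW⟩, fun h => hv h.1⟩
    rw [mem_cube] at hu ⊢
    intro j
    have h1 := abs_le.1 (hu j)
    have h2 := abs_le.1 (huv j)
    rw [abs_le]
    constructor <;> linarith
  have hcard : (Λ.crossingEdges G (cube c r) W).card ≤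
      ((A \ B) ×ˢ (Finset.univ : Finset (Fin D))).card := by
    refine Finset.card_le_card_of_injOn
      (fun e => (if Λ.blackEnd e ∈ A \ B ∧ whiteEnd e ∈ cube c r then Λ.blackEnd e
        else whiteEnd e, e.2)) ?_ ?_
    · intro e he
      obtain ⟨-, h⟩ := Finset.mem_filter.1 he
      refine Finset.mem_coe.2 (Finset.mem_product.2 ⟨?_, Finset.mem_univ _⟩)
      dsimp only
      rcases h with ⟨h1, h2, h3⟩ | ⟨h1, h2, h3⟩
      · have h4 := hin _ _ (hnear e) h1 h2 h3
        rwa [if_pos ⟨h4, h1⟩]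
      · rw [if_neg fun h => h2 h.2]
        exact hin _ _ (fun j => by rw [abs_sub_comm]; exact hnear e j) h1 h2 h3
    · rintro ⟨w, i⟩ - ⟨w', i'⟩ - h
      obtain ⟨h1, h2⟩ := Prod.mk.inj h
      dsimp only at h2
      subst h2
      split_ifs at h1
      · simpa [blackEnd] using h1
      · simp [blackEnd, whiteEnd] at h1
      · simp [blackEnd, whiteEnd] at h1
      · simpa [whiteEnd] using h1
  rw [Finset.card_product, Finset.card_univ, Fintype.card_fin] at hcard
  calc ((Λ.crossingEdges G (cube c r) W).card : ℝ) ≤ ((A \ B).card * D : ℕ) := by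
        exact_mod_cast hcard
    _ = _ := by push_cast; ring

theorem cutCost_nonneg {S : Finset (LVertex d)} {N : ℕ} {M' : LEdge d D → ℕ}
    (hM' : Λ.IsDimerCover S N M') (U : Finset (LVertex d)) (e : LEdge d D) :
    0 ≤ Λ.cutCost N M' U e := by
  have := hM'.le e
  unfold cutCost
  split_ifs <;> omega

/-- At interior vertices both covers have multiplicity N, so only boundary vertices contribute. A
cut can therefore be changed in the interior without affecting the discrepancy. -/
theorem signedDiff_congr {S : Finset (LVertex d)} {N : ℕ} {M M' : LEdge d D → ℕ}
    (hM : Λ.IsDimerCover S N M) (hM' : Λ.IsDimerCover S N M') {U U' : Finset (LVertex d)}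
    (hU : U ⊆ S) (hU' : U' ⊆ S) (h : ∀ v ∈ Λ.boundary S, v ∈ U ↔ v ∈ U') :
    Λ.signedDiff S M M' U = Λ.signedDiff S M M' U' := by
  classical
  have h0 : ∀ v ∈ S, v ∉ Λ.boundary S →
      sign v * (((Λ.vertexSum S M v : ℕ) : ℤ) - (Λ.vertexSum S M' v : ℕ)) = 0 := by
    intro v hv hvb
    rw [hM.interior_eq v ⟨hv, hvb⟩, hM'.interior_eq v ⟨hv, hvb⟩, sub_self, mul_zero]
  have h1 : ∀ V ⊆ S, Λ.signedDiff S M M' V = ∑ v ∈ V.filter fun v => v ∈ Λ.boundary S,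
      sign v * (((Λ.vertexSum S M v : ℕ) : ℤ) - (Λ.vertexSum S M' v : ℕ)) := by
    intro V hV
    rw [signedDiff, Finset.sum_filter]
    refine Finset.sum_congr rfl fun v hv => ?_
    split_ifs with hvb
    · rfl
    · exact h0 v (hV hv) hvb
  rw [h1 U hU, h1 U' hU']
  congr 1
  ext v
  simp only [Finset.mem_filter]
  constructor
  · rintro ⟨h2, h3⟩
    exact ⟨(h v h3).1 h2, h3⟩
  · rintro ⟨h2, h3⟩
    exact ⟨(h v h3).2 h2, h3⟩

open Classical in
theorem signedDiff_le {S : Finset (LVertex d)} {N : ℕ} {M M' : LEdge d D → ℕ}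
    (hM : Λ.IsDimerCover S N M) (hM' : Λ.IsDimerCover S N M') {b : ℝ} (hb : 0 ≤ b)
    (hbdry : ∀ v ∈ Λ.boundary S,
      |((Λ.vertexSum S M v : ℕ) : ℝ) - (Λ.vertexSum S M' v : ℕ)| ≤ b)
    {U : Finset (LVertex d)} (hU : U ⊆ S) :
    (Λ.signedDiff S M M' U : ℝ) ≤ b * (S.filter fun v => v ∈ Λ.boundary S).card := by
  have h1 : Λ.signedDiff S M M' U = Λ.signedDiff S M M' (U.filter fun v => v ∈ Λ.boundary S) :=
    signedDiff_congr hM hM' hU ((Finset.filter_subset _ _).trans hU) fun v hv => by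
      simp [hv]
  rw [h1, signedDiff]
  push_cast
  have h2 : ∀ v ∈ U.filter fun v => v ∈ Λ.boundary S,
      (sign v : ℝ) * (((Λ.vertexSum S M v : ℕ) : ℝ) - (Λ.vertexSum S M' v : ℕ)) ≤ b := by
    intro v hv
    have h3 := hbdry v (Finset.mem_filter.1 hv).2
    rw [abs_le] at h3
    rcases v with v | v <;> simp only [sign, Sum.elim_inl, Sum.elim_inr] <;> push_cast <;>
      linarith
  refine (Finset.sum_le_card_nsmul _ _ _ h2).trans ?_
  rw [nsmul_eq_mul, mul_comm]
  refine mul_le_mul_of_nonneg_left ?_ hb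
  exact_mod_cast Finset.card_le_card (Finset.filter_subset_filter _ hU)

end DimerLattice

/-! ### From local triviality to a valid cut inequality -/

namespace DimerLattice

variable {d D : ℕ} {Λ : DimerLattice d D}

/-- An optimal cut that is locally trivial in the collar can be made trivial further inside, and
is therefore not violated. -/
theorem signedDiff_le_of_locally_trivial {R : Set (EuclideanSpace ℝ (Fin d))}
    (hconn : IsConnected (frontier R)) {κ : ℝ} (hκ : 0 < κ) {n : ℕ} {S T : Finset (LVertex d)}
    {N : ℕ} {M M' : LEdge d D → ℕ} (hM : Λ.IsDimerCover S N M) (hM' : Λ.IsDimerCover S N M')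
    (hbdry : ∀ v ∈ Λ.boundary S, depth R (Λ.scaledPos n v) < κ / 4)
    (hT : ∀ v ∈ Λ.interior T, 7 * κ < depth R (Λ.scaledPos n v))
    (hedge : ∀ e : LEdge d D,
      dist (Λ.scaledPos n (whiteEnd e)) (Λ.scaledPos n (Λ.blackEnd e)) < κ / 4)
    (hS : ∀ v, κ / 2 ≤ depth R (Λ.scaledPos n v) → v ∈ S) {r₀ : ℝ} (hr₀ : 0 < r₀)
    (hdense : ∀ x, ∃ v, dist (Λ.scaledPos n v) x < r₀ / 2) {U : Finset (LVertex d)} (hU : U ⊆ S)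
    (hloc : ∀ x, κ < depth R x → depth R x < 2 * κ →
      (∀ v, dist (Λ.scaledPos n v) x < r₀ → v ∈ U) ∨
        ∀ v, dist (Λ.scaledPos n v) x < r₀ → v ∉ U)
    (hmax : ∀ U' ⊆ S, Λ.signedDiff S M M' U' - ∑ e ∈ Λ.free S T, Λ.cutCost N M' U' e ≤
      Λ.signedDiff S M M' U - ∑ e ∈ Λ.free S T, Λ.cutCost N M' U e) :
    Λ.signedDiff S M M' U ≤ ∑ e ∈ Λ.free S T, Λ.cutCost N M' U e := by
  classical
  -- In the collar this is the common value of the indicator of U near x. It is locally constant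
  -- because nearby points have a vertex in common within distance r₀.
  let g : EuclideanSpace ℝ (Fin d) → ℝ := fun x =>
    if ∃ v ∈ U, dist (Λ.scaledPos n v) x < r₀ then 1 else 0
  have hg_iff : ∀ x, κ < depth R x → depth R x < 2 * κ → ∀ v, dist (Λ.scaledPos n v) x < r₀ →
      (v ∈ U ↔ g x = 1) := by
    intro x hx1 hx2 v hv
    rcases hloc x hx1 hx2 with h | h
    · have : g x = 1 := if_pos ⟨v, h v hv, hv⟩
      simp [this, h v hv]
    · have : g x = 0 := if_neg fun ⟨u, hu, hux⟩ => h u hux hu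
      simp [this, h v hv]
  have hg01 : ∀ x, g x = 0 ∨ g x = 1 := by
    intro x
    simp only [g]
    split_ifs
    exacts [Or.inr rfl, Or.inl rfl]
  have hdc := continuous_depth R
  have hgloc : ∀ x, κ < depth R x → depth R x < 2 * κ → ∀ᶠ y in 𝓝 x, g y = g x := by
    intro x hx1 hx2
    obtain ⟨v, hv⟩ := hdense x
    filter_upwards [Metric.ball_mem_nhds x (half_pos hr₀),
      hdc.continuousAt.eventually (lt_mem_nhds hx1),
      hdc.continuousAt.eventually (gt_mem_nhds hx2)] with y hy hy1 hy2
    have h1 := hg_iff x hx1 hx2 v (by linarith)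
    have h2 := hg_iff y hy1 hy2 v (by
      have := dist_triangle (Λ.scaledPos n v) x y
      rw [Metric.mem_ball, dist_comm] at hy
      linarith)
    rw [h1] at h2
    rcases hg01 x with hx | hx <;> rcases hg01 y with hy | hy <;> simp_all
  obtain ⟨G, hGg, hG⟩ := exists_extension_of_locally_constant hconn hκ g hgloc hg01
  have hedge' : ∀ e : LEdge d D,
      |depth R (Λ.scaledPos n (whiteEnd e)) - depth R (Λ.scaledPos n (Λ.blackEnd e))| < κ / 4 := by
    intro e
    have h1 := depth_le_depth_add_dist R (Λ.scaledPos n (whiteEnd e))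
      (Λ.scaledPos n (Λ.blackEnd e))
    have h2 := depth_le_depth_add_dist R (Λ.scaledPos n (Λ.blackEnd e))
      (Λ.scaledPos n (whiteEnd e))
    have h3 := hedge e
    rw [dist_comm] at h2
    rw [abs_lt]
    constructor <;> linarith
  have hGedge : ∀ e : LEdge d D, 3 / 2 * κ ≤ depth R (Λ.scaledPos n (whiteEnd e)) →
      G (Λ.scaledPos n (whiteEnd e)) = G (Λ.scaledPos n (Λ.blackEnd e)) := by
    intro e he
    refine hG _ _ fun z hz => ?_
    have h1 : z ∈ Metric.ball (Λ.scaledPos n (whiteEnd e)) (κ / 4) :=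
      (convex_ball _ _).segment_subset (Metric.mem_ball_self (by linarith))
        (by rw [Metric.mem_ball, dist_comm]; exact hedge e) hz
    have h2 := depth_le_depth_add_dist R (Λ.scaledPos n (whiteEnd e)) z
    rw [Metric.mem_ball, dist_comm] at h1
    linarith
  -- U is kept near the boundary and replaced by the extension deeper inside. The two descriptions
  -- agree at depths between 3κ/2 and 2κ, a layer that edges shorter than κ/4 cannot jump.
  set U' : Finset (LVertex d) := S.filter fun v =>
    if 3 / 2 * κ ≤ depth R (Λ.scaledPos n v) then G (Λ.scaledPos n v) = 1 else v ∈ U with hU'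
  have hU'S : U' ⊆ S := Finset.filter_subset _ _
  have hdeep : ∀ v, 3 / 2 * κ ≤ depth R (Λ.scaledPos n v) →
      (v ∈ U' ↔ G (Λ.scaledPos n v) = 1) := by
    intro v hv
    rw [hU', Finset.mem_filter, if_pos hv]
    exact and_iff_right (hS v (by linarith))
  have hshallow : ∀ v ∈ S, depth R (Λ.scaledPos n v) < 2 * κ → (v ∈ U' ↔ v ∈ U) := by
    intro v hvS hv
    rcases lt_or_ge (depth R (Λ.scaledPos n v)) (3 / 2 * κ) with h | h
    · rw [hU', Finset.mem_filter, if_neg (not_le.2 h)]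
      exact and_iff_right hvS
    · rw [hdeep v h, hGg _ (by linarith) hv]
      exact (hg_iff _ (by linarith) hv v (by rwa [dist_self])).symm
  have hfrozen : ∀ e ∈ Λ.frozen S T, whiteEnd e ∈ U' ↔ Λ.blackEnd e ∈ U' := by
    intro e he
    have h1 := abs_lt.1 (hedge' e)
    have h2 : 3 / 2 * κ ≤ depth R (Λ.scaledPos n (whiteEnd e)) ∧
        3 / 2 * κ ≤ depth R (Λ.scaledPos n (Λ.blackEnd e)) := by
      rcases (Finset.mem_filter.1 he).2 with h | h
      · have := hT _ h
        constructor <;> linarith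
      · have := hT _ h
        constructor <;> linarith
    rw [hdeep _ h2.1, hdeep _ h2.2, hGedge e h2.1]
  have h1 := signedDiff_le_of_not_cut_frozen (M' := M') hM U' hfrozen
  have h2 : Λ.signedDiff S M M' U = Λ.signedDiff S M M' U' :=
    signedDiff_congr hM hM' hU hU'S fun v hv =>
      (hshallow v hv.1 (by have := hbdry v hv; linarith)).symm
  have h3 : ∑ e ∈ Λ.free S T, Λ.cutCost N M' U' e ≤ ∑ e ∈ Λ.free S T, Λ.cutCost N M' U e := by
    refine Finset.sum_le_sum fun e he => ?_
    have heS : e ∈ Λ.edges S := Λ.mem_edgeFinset.1 (Finset.mem_filter.1 he).1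
    have h4 := abs_lt.1 (hedge' e)
    -- If both ends are deep, the extension does not cut the edge. Otherwise both depths are below
    -- 2κ, where the old and new cuts coincide.
    by_cases hw : 3 / 2 * κ ≤ depth R (Λ.scaledPos n (whiteEnd e)) ∧
      3 / 2 * κ ≤ depth R (Λ.scaledPos n (Λ.blackEnd e))
    · have h5 : whiteEnd e ∈ U' ↔ Λ.blackEnd e ∈ U' := by
        rw [hdeep _ hw.1, hdeep _ hw.2, hGedge e hw.1]
      have h6 : Λ.cutCost N M' U' e = 0 := by
        unfold cutCost
        rw [if_neg (by tauto), if_neg (by tauto)]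
      rw [h6]
      exact cutCost_nonneg hM' U e
    · have h5 : depth R (Λ.scaledPos n (whiteEnd e)) < 2 * κ ∧
          depth R (Λ.scaledPos n (Λ.blackEnd e)) < 2 * κ := by
        rw [not_and_or, not_le, not_le] at hw
        rcases hw with h | h <;> constructor <;> linarith
      have h6 := hshallow _ heS.1 h5.1
      have h7 := hshallow _ heS.2 h5.2
      unfold cutCost
      simp only [h6, h7, le_refl]
  have h4 := hmax U' hU'S
  linarith

/-- Deep lattice points belong to approximating regions. -/
theorem eventually_forall_mem_of_le_depth {R : Set (EuclideanSpace ℝ (Fin d))}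
    {S : ℕ → Finset (LVertex d)} (hS : Λ.HausdorffApprox (fun n => (S n : Set (LVertex d))) R)
    {κ : ℝ} (hκ : 0 < κ)
    (hbdry : ∀ᶠ n in atTop, ∀ v ∈ Λ.boundary (S n), depth R (Λ.scaledPos n v) < κ / 4) :
    ∀ᶠ n in atTop, ∀ v, κ / 2 ≤ depth R (Λ.scaledPos n v) → v ∈ S n := by
  classical
  obtain ⟨C, hC⟩ := Λ.exists_isDistortion
  obtain ⟨s, -, hs⟩ := Λ.exists_isRange
  have hC0 := hC.1
  have hη : 0 < κ / (16 * C ^ 2) := by positivity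
  have hn1 : ∀ᶠ n : ℕ in atTop, C * (s + 3) / n < κ / 8 :=
    (tendsto_const_div_atTop_nhds_zero_nat (C * (s + 3))).eventually
      (gt_mem_nhds (by positivity))
  filter_upwards [hbdry, hS.eventually hη, hn1, eventually_gt_atTop 0] with n hb hSn hn hn0 v hv
  have hnR : (0 : ℝ) < n := by exact_mod_cast hn0
  have hvR : Λ.scaledPos n v ∈ R := mem_of_depth_pos (by linarith)
  obtain ⟨u, hu, huv⟩ := hSn.2 _ hvR
  rw [dist_scaledPos, inv_mul_lt_iff₀ hnR] at huv
  set r : ℕ := ⌈C * (n * (κ / (16 * C ^ 2))) + 1⌉₊ with hr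
  have hr1 : C * (n * (κ / (16 * C ^ 2))) + 1 ≤ r := Nat.le_ceil _
  have hr2 : (r : ℝ) < C * (n * (κ / (16 * C ^ 2))) + 1 + 1 := Nat.ceil_lt_add_one (by positivity)
  have hdist : ∀ x ∈ cube (coord v) ((r : ℤ) + s),
      κ / 4 ≤ depth R (Λ.scaledPos n x) := by
    intro x hx
    have h1 : ‖Λ.pos v - Λ.pos x‖ ≤ C * ((r + s : ℝ) + 1) := by
      refine norm_pos_sub_le hC (by positivity) fun j => ?_
      rw [abs_sub_comm]
      exact_mod_cast mem_cube.1 hx j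
    have h2 : dist (Λ.scaledPos n v) (Λ.scaledPos n x) ≤ κ / 4 := by
      rw [dist_scaledPos, inv_mul_le_iff₀ hnR]
      rw [div_lt_iff₀ hnR] at hn
      have h3 : C * (C * (n * (κ / (16 * C ^ 2)))) = n * (κ / 16) := by
        field_simp
      nlinarith
    have h3 := depth_le_depth_add_dist R (Λ.scaledPos n v) (Λ.scaledPos n x)
    linarith
  -- The cube is too deep to contain boundary vertices of S, so S cuts none of its edges and
  -- contains either all or none of its central part, which includes both u and v.
  have hempty : Λ.cutEdges (S n : Set (LVertex d)) (cube (coord v) ((r : ℤ) + s)) = ∅ := by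
    rw [Finset.eq_empty_iff_forall_notMem]
    intro e he
    obtain ⟨⟨hw, hbk⟩, hcut⟩ := mem_cutEdges.1 he
    simp only [Finset.mem_coe] at hcut
    by_cases hwS : whiteEnd e ∈ S n
    · have hbS : Λ.blackEnd e ∉ S n := fun h => hcut ⟨fun _ => h, fun _ => hwS⟩
      have := hb _ ⟨hwS, Λ.blackEnd e, hbS, Λ.adj_iff.2 ⟨e, Or.inl ⟨rfl, rfl⟩⟩⟩
      have := hdist _ hw
      linarith
    · have hbS : Λ.blackEnd e ∈ S n := by
        by_contra h
        exact hcut ⟨fun h' => absurd h' hwS, fun h' => absurd h' h⟩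
      have := hb _ ⟨hbS, whiteEnd e, hwS, Λ.adj_iff.2 ⟨e, Or.inr ⟨rfl, rfl⟩⟩⟩
      have := hdist _ hbk
      linarith
  have hucube : u ∈ cube (coord v) (r : ℤ) := by
    rw [mem_cube]
    intro j
    have h1 := abs_coord_sub_le hC u v j
    have h2 : C * ‖Λ.pos u - Λ.pos v‖ ≤ C * (n * (κ / (16 * C ^ 2))) := by gcongr
    have h3 : |(coord u j : ℝ) - coord v j| ≤ r := by linarith
    exact_mod_cast h3
  have hvcube : v ∈ cube (coord v) (r : ℤ) := by
    rw [mem_cube]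
    intro j
    simp
  rcases forall_mem_or_forall_notMem_of_cutEdges_eq_empty hs (S n : Set (LVertex d)) (coord v) r
    hempty with h | h
  · exact h v hvcube
  · exact absurd hu (h u hucube)

end DimerLattice

/-! ### Quasi-minimality of optimal cuts and deterministic patching -/

namespace DimerLattice

variable {d D : ℕ} {Λ : DimerLattice d D}

theorem cutEdges_subset_free {S T Q : Finset (LVertex d)} (U : Set (LVertex d)) (hQS : Q ⊆ S)
    (hQT : ∀ e ∈ Λ.frozen S T, whiteEnd e ∈ Q → Λ.blackEnd e ∉ Q) :
    Λ.cutEdges U Q ⊆ Λ.free S T := by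
  classical
  intro e he
  obtain ⟨⟨hw, hb⟩, -⟩ := mem_cutEdges.1 he
  have heS : e ∈ Λ.edgeFinset S := Λ.mem_edgeFinset.2 ⟨hQS hw, hQS hb⟩
  refine Finset.mem_filter.2 ⟨heS, fun h => ?_⟩
  exact hQT e (Finset.mem_filter.2 ⟨heS, h⟩) hw hb

/-- An optimal cut is quasi-minimal in cubes. -/
theorem card_cutEdges_le_of_maximal {s : ℕ} (hs : Λ.IsRange s) {S T : Finset (LVertex d)}
    {N : ℕ} (hN : 0 < N) {M M' : LEdge d D → ℕ} (hM : Λ.IsDimerCover S N M)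
    (hM' : Λ.IsDimerCover S N M') {a : ℝ} (ha : ∀ e ∈ Λ.edges S, a * N ≤ M' e)
    {U : Finset (LVertex d)} (hU : U ⊆ S)
    (hmax : ∀ U' ⊆ S, Λ.signedDiff S M M' U' - ∑ e ∈ Λ.free S T, Λ.cutCost N M' U' e ≤
      Λ.signedDiff S M M' U - ∑ e ∈ Λ.free S T, Λ.cutCost N M' U e)
    {c : Fin d → ℤ} {r : ℤ} (hQS : ∀ v ∈ cube c r, v ∈ Λ.interior S)
    (hQT : ∀ e ∈ Λ.frozen S T, whiteEnd e ∈ cube c r → Λ.blackEnd e ∉ cube c r)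
    (W : Set (LVertex d)) (hW : W = U ∨ W = (U : Set (LVertex d))ᶜ) :
    a * (Λ.cutEdges W (cube c r)).card ≤
      2 * D * ((cubeCount W c (r + s) : ℝ) - cubeCount W c r) := by
  classical
  set Q := cube c r with hQ
  have hQS' : Q ⊆ S := fun v hv => (hQS v hv).1
  -- The competitor empties Q when W = U and fills it when W = Uᶜ. In both cases W is where U
  -- disagrees with the value p given to Q.
  obtain ⟨U', p, hU'S, hoff, hon, hWp, hcutW⟩ : ∃ (U' : Finset (LVertex d)) (p : Prop), U' ⊆ S ∧
      (∀ v, v ∉ Q → (v ∈ U' ↔ v ∈ U)) ∧ (∀ v ∈ Q, v ∈ U' ↔ p) ∧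
      (∀ v, v ∈ W ↔ (v ∈ U ↔ ¬ p)) ∧ Λ.cutEdges W Q = Λ.cutEdges (U : Set (LVertex d)) Q := by
    rcases hW with rfl | rfl
    · refine ⟨U \ Q, False, Finset.sdiff_subset.trans hU, fun v hv => ?_, fun v hv => ?_,
        fun v => ?_, rfl⟩
      · simp [hv]
      · simp [hv]
      · simp
    · refine ⟨U ∪ Q, True, Finset.union_subset hU hQS', fun v hv => ?_, fun v hv => ?_,
        fun v => ?_, Λ.cutEdges_compl _ _⟩
      · simp [hv]
      · simp [hv]
      · simp
  have hflip := sum_cutCost_flip_le hM' ha (cutEdges_subset_free (U : Set (LVertex d)) hQS' hQT) p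
    hoff hon hWp
  have hsd : Λ.signedDiff S M M' U = Λ.signedDiff S M M' U' :=
    signedDiff_congr hM hM' hU hU'S fun v hv =>
      (hoff v fun hvQ => (hQS v hvQ).2 hv).symm
  have h1 := hmax U' hU'S
  have h2 : ∑ e ∈ Λ.free S T, Λ.cutCost N M' U e ≤ ∑ e ∈ Λ.free S T, Λ.cutCost N M' U' e := by
    linarith
  have h3 : ∑ e ∈ Λ.free S T, (Λ.cutCost N M' U e : ℝ) ≤
      ∑ e ∈ Λ.free S T, (Λ.cutCost N M' U' e : ℝ) := by exact_mod_cast h2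
  have h4 := card_crossingEdges_le hs (Λ.free S T) c r W
  have hNR : (0 : ℝ) < N := by exact_mod_cast hN
  have h5 : (a * (Λ.cutEdges W Q).card) * N ≤
      (2 * ((Λ.crossingEdges (Λ.free S T) Q W).card : ℝ)) * N := by
    rw [hcutW]
    linarith
  have h6 := le_of_mul_le_mul_right h5 hNR
  linarith

open Classical in
/-- A violated cut has few edges. -/
theorem card_cutEdges_le_card_boundary {S T Q : Finset (LVertex d)} {N : ℕ}
    {M M' : LEdge d D → ℕ} (hM : Λ.IsDimerCover S N M) (hM' : Λ.IsDimerCover S N M') {a b : ℝ}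
    (ha : ∀ e ∈ Λ.edges S, a * N ≤ M' e) (hb : 0 ≤ b)
    (hbdry : ∀ v ∈ Λ.boundary S,
      |((Λ.vertexSum S M v : ℕ) : ℝ) - (Λ.vertexSum S M' v : ℕ)| ≤ b)
    {U : Finset (LVertex d)} (hU : U ⊆ S)
    (hviol : ∑ e ∈ Λ.free S T, Λ.cutCost N M' U e ≤ Λ.signedDiff S M M' U)
    (hQ : Λ.cutEdges (U : Set (LVertex d)) Q ⊆ Λ.free S T) :
    a * N * (Λ.cutEdges (U : Set (LVertex d)) Q).card ≤
      b * (S.filter fun v => v ∈ Λ.boundary S).card := by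
  have h1 : a * N * (Λ.cutEdges (U : Set (LVertex d)) Q).card ≤
      ∑ e ∈ Λ.cutEdges (U : Set (LVertex d)) Q, (Λ.cutCost N M' U e : ℝ) := by
    rw [mul_comm, ← nsmul_eq_mul]
    -- A cut edge costs M' or 2N - M' ≥ N ≥ M', hence at least aN in either direction.
    refine Finset.card_nsmul_le_sum _ _ _ fun e he => ?_
    have heS : e ∈ Λ.edges S := Λ.mem_edgeFinset.1 (Finset.mem_filter.1 (hQ he)).1
    have h2 := ha e heS
    have h3 : (M' e : ℝ) ≤ N := by exact_mod_cast hM'.le e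
    have h4 := (mem_cutEdges.1 he).2
    simp only [Finset.mem_coe] at h4
    unfold cutCost
    by_cases hw : whiteEnd e ∈ U <;> by_cases hbk : Λ.blackEnd e ∈ U <;>
      simp [hw, hbk] at h4 ⊢ <;> linarith
  have h2 : ∑ e ∈ Λ.cutEdges (U : Set (LVertex d)) Q, (Λ.cutCost N M' U e : ℝ) ≤
      ∑ e ∈ Λ.free S T, (Λ.cutCost N M' U e : ℝ) :=
    Finset.sum_le_sum_of_subset_of_nonneg hQ fun e _ _ => by
      exact_mod_cast cutCost_nonneg hM' U e
  have h3 : ∑ e ∈ Λ.free S T, (Λ.cutCost N M' U e : ℝ) ≤ Λ.signedDiff S M M' U := by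
    exact_mod_cast hviol
  exact h1.trans (h2.trans (h3.trans (signedDiff_le hM hM' hb hbdry hU)))

/-- The deterministic part of the patching theorem. -/
theorem eventually_patchable {δ : ℝ} (hδ : 0 < δ)
    {R : Set (EuclideanSpace ℝ (Fin d))} (hR : IsCompact R) (hconn : IsConnected (frontier R))
    (hnull : volume (frontier R) = 0) {S T : ℕ → Finset (LVertex d)}
    (hS : Λ.HausdorffApprox (fun n => (S n : Set (LVertex d))) R)
    (hS_bdry : Λ.HausdorffApprox (fun n => Λ.boundary (S n)) (frontier R))
    (hT : Λ.HausdorffApprox (fun n => (T n : Set (LVertex d)))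
      {x | x ∈ R ∧ δ < Metric.infDist x (frontier R)}) {a : ℝ} (ha : 0 < a) {b : ℝ} (hb : 0 ≤ b) :
    ∀ᶠ n : ℕ in atTop, ∀ N : ℕ, 0 < N → ∀ M M' : LEdge d D → ℕ,
      Λ.IsDimerCover (S n) N M → Λ.IsDimerCover (S n) N M' →
      (∀ v ∈ Λ.boundary (S n),
        |((Λ.vertexSum (S n) M v : ℕ) : ℝ) - (Λ.vertexSum (S n) M' v : ℕ)| ≤ b / n * N) →
      (∀ e ∈ Λ.edges (S n), a * N ≤ M' e) → Λ.Patchable (S n) (T n) N M M' := by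
  classical
  obtain ⟨C, hC⟩ := Λ.exists_isDistortion
  obtain ⟨s, -, hs⟩ := Λ.exists_isRange
  obtain ⟨K, c₀, hc₀, hK1, hclear⟩ := exists_clearing hs a (2 * D) ha (by positivity)
  have hC0 := hC.1
  -- The collar has depth between κ and 2κ, while the interior of T lies deeper than 7κ, well
  -- separated from the cubes used below.
  set κ : ℝ := δ / 8 with hκδ
  have hκ : 0 < κ := by positivity
  have hKR : (1 : ℝ) ≤ K := by exact_mod_cast hK1
  -- The dyadic scale will satisfy c₁n/2 < 2^j ≤ c₁n, so a cube of radius K 2^j has macroscopic size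
  -- about κ/8 and stays near the collar.
  set c₁ : ℝ := κ / (8 * C * K) with hc₁
  have hc₁0 : 0 < c₁ := by positivity
  -- Chosen so that boundary cardinality at most ε n^d yields the smallness of the cut demanded by
  -- the clearing lemma. The summand 1 in b + 1 covers b = 0.
  set ε : ℝ := c₀ * (c₁ / 2) ^ d * a / ((b + 1) * c₁) with hε
  have hε0 : 0 < ε := by positivity
  obtain ⟨η, hη0, hη⟩ := exists_card_le_of_volume_eq_zero (Λ := Λ)
    (hR.of_isClosed_subset isClosed_frontier hR.isClosed.frontier_subset) hnull hε0
  have hbd : ∀ᶠ n in atTop, ∀ v ∈ Λ.boundary (S n), depth R (Λ.scaledPos n v) < κ / 4 := by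
    filter_upwards [hS_bdry.eventually (show 0 < κ / 4 by positivity)] with n hn v hv
    obtain ⟨x, hx, hvx⟩ := hn.1 v hv
    exact (depth_le_dist R _ hx).trans_lt hvx
  have hdeep := eventually_forall_mem_of_le_depth hS hκ hbd
  have hn1 : ∀ᶠ n : ℕ in atTop, C * (s + 3) / n < κ / 8 :=
    (tendsto_const_div_atTop_nhds_zero_nat (C * (s + 3))).eventually
      (gt_mem_nhds (by positivity))
  have hn2 : ∀ᶠ n : ℕ in atTop, C / n < c₁ / (4 * C) / 2 :=
    (tendsto_const_div_atTop_nhds_zero_nat C).eventually (gt_mem_nhds (by positivity))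
  have hn3 : ∀ᶠ n : ℕ in atTop, (C ^ 2 + 1) / n < c₁ / 4 :=
    (tendsto_const_div_atTop_nhds_zero_nat (C ^ 2 + 1)).eventually
      (gt_mem_nhds (by positivity))
  filter_upwards [hbd, hdeep, hT.eventually hκ, hS_bdry.eventually hη0, hη, hn1, hn2, hn3,
    eventually_gt_atTop 0] with n hbdry hmem hTn hSn hcount hn1 hn2 hn3 hn0
  intro N hN M M' hM hM' hMM' haM'
  have hnR : (0 : ℝ) < n := by exact_mod_cast hn0
  have hNR : (0 : ℝ) < N := by exact_mod_cast hN
  rw [div_lt_iff₀ hnR] at hn1 hn2 hn3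
  have hTdeep : ∀ v ∈ Λ.interior (T n), 7 * κ < depth R (Λ.scaledPos n v) := by
    intro v hv
    obtain ⟨x, ⟨hxR, hx⟩, hvx⟩ := hTn.1 v hv.1
    have h1 := depth_le_depth_add_dist R x (Λ.scaledPos n v)
    rw [dist_comm] at hvx
    rw [depth_of_mem hxR] at h1
    have : δ = 8 * κ := by rw [hκδ]; ring
    linarith
  have hedge : ∀ e : LEdge d D,
      dist (Λ.scaledPos n (whiteEnd e)) (Λ.scaledPos n (Λ.blackEnd e)) < κ / 4 := by
    intro e
    have h1 : ‖Λ.pos (whiteEnd e) - Λ.pos (Λ.blackEnd e)‖ ≤ C * ((s : ℝ) + 1) := by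
      refine norm_pos_sub_le hC (by positivity) fun j => ?_
      have h2 : coord (whiteEnd e) j - coord (Λ.blackEnd e) j = -Λ.shift e.2 j := by
        simp [coord, whiteEnd, blackEnd]
      have h3 : |coord (whiteEnd e) j - coord (Λ.blackEnd e) j| ≤ s := by
        rw [h2, abs_neg]
        exact hs.1 _ _
      exact_mod_cast h3
    rw [dist_scaledPos, inv_mul_lt_iff₀ hnR]
    nlinarith
  have hfrozen : ∀ e ∈ Λ.frozen (S n) (T n), 4 * κ < depth R (Λ.scaledPos n (whiteEnd e)) ∧
      4 * κ < depth R (Λ.scaledPos n (Λ.blackEnd e)) := by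
    intro e he
    have h1 := hedge e
    have h2 := depth_le_depth_add_dist R (Λ.scaledPos n (whiteEnd e))
      (Λ.scaledPos n (Λ.blackEnd e))
    have h3 := depth_le_depth_add_dist R (Λ.scaledPos n (Λ.blackEnd e))
      (Λ.scaledPos n (whiteEnd e))
    rw [dist_comm] at h3
    rcases (Finset.mem_filter.1 he).2 with h | h
    · have := hTdeep _ h
      constructor <;> linarith
    · have := hTdeep _ h
      constructor <;> linarith
  have hint : ∀ v, κ / 2 ≤ depth R (Λ.scaledPos n v) → v ∈ Λ.interior (S n) := fun v hv =>
    ⟨hmem v hv, fun h => by have := hbdry v h; linarith⟩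
  refine patchable_of_cuts hM hM' (fun e he => ⟨hint _ (by linarith [(hfrozen e he).1]),
    hint _ (by linarith [(hfrozen e he).2])⟩) ?_
  obtain ⟨U, hUS, hmax⟩ := Finset.exists_max_image (S n).powerset
    (fun U => Λ.signedDiff (S n) M M' U - ∑ e ∈ Λ.free (S n) (T n), Λ.cutCost N M' U e)
    ⟨∅, Finset.empty_mem_powerset _⟩
  rw [Finset.mem_powerset] at hUS
  replace hmax : ∀ U' ⊆ S n, Λ.signedDiff (S n) M M' U' -
      ∑ e ∈ Λ.free (S n) (T n), Λ.cutCost N M' U' e ≤ Λ.signedDiff (S n) M M' U -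
      ∑ e ∈ Λ.free (S n) (T n), Λ.cutCost N M' U e := fun U' hU' =>
    hmax U' (Finset.mem_powerset.2 hU')
  -- The empty cut has discrepancy and cost zero, so the maximizer has discrepancy at least its
  -- cost.
  have hviol : ∑ e ∈ Λ.free (S n) (T n), Λ.cutCost N M' U e ≤ Λ.signedDiff (S n) M M' U := by
    have := hmax ∅ (Finset.empty_subset _)
    simp only [signedDiff, Finset.sum_empty, cutCost, Finset.notMem_empty, false_and, if_false,
      Finset.sum_const_zero, sub_zero] at this
    simp only [signedDiff, cutCost]
    linarith
  have hc₁n : 1 ≤ c₁ * n := by nlinarith [sq_nonneg C]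
  obtain ⟨j, hj1, hj2⟩ := exists_nat_pow_near hc₁n one_lt_two
  rw [pow_succ] at hj2
  have hloc : ∀ x, κ < depth R x → depth R x < 2 * κ →
      (∀ v, dist (Λ.scaledPos n v) x < c₁ / (4 * C) → v ∈ U) ∨
        ∀ v, dist (Λ.scaledPos n v) x < c₁ / (4 * C) → v ∉ U := by
    intro x hx1 hx2
    obtain ⟨z, hz⟩ := exists_norm_pos_sub_le hC ((n : ℝ) • x)
    have hdistx : ∀ v : LVertex d, dist (Λ.scaledPos n v) x =
        (n : ℝ)⁻¹ * ‖Λ.pos v - (n : ℝ) • x‖ := by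
      intro v
      have : Λ.scaledPos n v - x = (n : ℝ)⁻¹ • (Λ.pos v - (n : ℝ) • x) := by
        rw [smul_sub, smul_smul, inv_mul_cancel₀ hnR.ne', one_smul]
        rfl
      rw [dist_eq_norm, this, norm_smul, Real.norm_eq_abs, abs_of_nonneg (by positivity)]
    have hcubedepth : ∀ v ∈ cube z (K * 2 ^ j), κ / 2 < depth R (Λ.scaledPos n v) ∧
        depth R (Λ.scaledPos n v) < 4 * κ := by
      intro v hv
      have h1 : ‖Λ.pos v - Λ.pos (Sum.inl z)‖ ≤ C * ((K * 2 ^ j : ℝ) + 1) := by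
        refine norm_pos_sub_le hC (by positivity) fun i => ?_
        exact_mod_cast mem_cube.1 hv i
      have h2 : ‖Λ.pos v - (n : ℝ) • x‖ ≤ C * ((K * 2 ^ j : ℝ) + 1) + C :=
        (norm_sub_le_norm_sub_add_norm_sub _ _ _).trans (add_le_add h1 hz)
      have h3 : dist (Λ.scaledPos n v) x < κ / 4 := by
        rw [hdistx, inv_mul_lt_iff₀ hnR]
        have h4 : C * (K * 2 ^ j) ≤ C * (K * (c₁ * n)) := by gcongr
        have h5 : C * (K * (c₁ * n)) = n * (κ / 8) := by
          rw [hc₁]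
          field_simp
        have hs0 : (0 : ℝ) ≤ s := by positivity
        nlinarith
      have h4 := depth_le_depth_add_dist R (Λ.scaledPos n v) x
      have h5 := depth_le_depth_add_dist R x (Λ.scaledPos n v)
      rw [dist_comm] at h5
      constructor <;> linarith
    have hsub : cube z (K * 2 ^ j) ⊆ S n := fun v hv => (hint v (hcubedepth v hv).1.le).1
    have hQT : ∀ e ∈ Λ.frozen (S n) (T n), whiteEnd e ∉ cube z ((K : ℤ) * 2 ^ j) := by
      intro e he hw
      have := (hfrozen e he).1
      have := (hcubedepth _ hw).2
      linarith
    have hfree := cutEdges_subset_free (U : Set (LVertex d)) hsub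
      fun e he hw => absurd hw (hQT e he)
    have hsmall := card_cutEdges_le_card_boundary hM hM' haM' (by positivity) hMM' hUS hviol hfree
    have hbcard := hcount ((S n).filter fun v => v ∈ Λ.boundary (S n)) fun v hv =>
      hSn.1 v (Finset.mem_filter.1 hv).2
    have hcut : ((Λ.cutEdges (U : Set (LVertex d)) (cube z (K * 2 ^ j))).card : ℝ) * 2 ^ j ≤
        c₀ * (2 ^ j) ^ d := by
      set q : ℝ := ((Λ.cutEdges (U : Set (LVertex d)) (cube z (K * 2 ^ j))).card : ℝ) with hq
      have hq0 : 0 ≤ q := by positivity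
      have h1 : a * N * q ≤ b / n * N * (ε * (n : ℝ) ^ d) :=
        hsmall.trans (mul_le_mul_of_nonneg_left hbcard (by positivity))
      have h2 : a * q * n ≤ b * ε * (n : ℝ) ^ d := by
        have h3 : (a * q * n) * N ≤ (b * ε * (n : ℝ) ^ d) * N := by
          calc (a * q * n) * N = (a * N * q) * n := by ring
            _ ≤ (b / n * N * (ε * (n : ℝ) ^ d)) * n := by gcongr
            _ = _ := by field_simp
        exact le_of_mul_le_mul_right h3 hNR
      have h3 : a * (q * 2 ^ j) ≤ a * (c₀ * (2 ^ j) ^ d) := by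
        calc a * (q * 2 ^ j) ≤ a * (q * (c₁ * n)) := by gcongr
          _ = (a * q * n) * c₁ := by ring
          _ ≤ (b * ε * (n : ℝ) ^ d) * c₁ := by gcongr
          _ ≤ ((b + 1) * ε * (n : ℝ) ^ d) * c₁ := by gcongr; linarith
          _ = a * (c₀ * (c₁ * n / 2) ^ d) := by
            rw [hε, mul_div_right_comm c₁ (n : ℝ) 2, mul_pow]
            field_simp
          _ ≤ a * (c₀ * (2 ^ j) ^ d) := by
            gcongr
            linarith
      exact le_of_mul_le_mul_left h3 ha
    have hball : ∀ v, dist (Λ.scaledPos n v) x < c₁ / (4 * C) → v ∈ cube z (2 ^ j) := by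
      intro v hv
      rw [mem_cube]
      intro i
      rw [hdistx, inv_mul_lt_iff₀ hnR] at hv
      have h1 := abs_coord_sub_le hC v (Sum.inl z) i
      have h2 : ‖Λ.pos v - Λ.pos (Sum.inl z)‖ ≤ n * (c₁ / (4 * C)) + C := by
        refine (norm_sub_le_norm_sub_add_norm_sub _ ((n : ℝ) • x) _).trans ?_
        rw [norm_sub_rev ((n : ℝ) • x)]
        exact add_le_add hv.le hz
      have h3 : C * ‖Λ.pos v - Λ.pos (Sum.inl z)‖ ≤ C * (n * (c₁ / (4 * C)) + C) := by gcongr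
      have h4 : C * (n * (c₁ / (4 * C)) + C) = c₁ / 4 * n + C ^ 2 := by field_simp
      have h5 : |(coord v i : ℝ) - z i| ≤ 2 ^ j := by
        have : (coord (Sum.inl z : LVertex d) i : ℝ) = z i := rfl
        rw [this] at h1
        linarith
      exact_mod_cast h5
    have hopt : ∀ W, W = (U : Set (LVertex d)) ∨ W = (U : Set (LVertex d))ᶜ → ∀ r : ℤ,
        r ≤ K * 2 ^ j → a * (Λ.cutEdges W (cube z r)).card ≤
          2 * D * ((cubeCount W z (r + s) : ℝ) - cubeCount W z r) := by
      intro W hW r hr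
      refine card_cutEdges_le_of_maximal hs hN hM hM' haM' hUS hmax ?_ ?_ W hW
      · intro v hv
        exact hint v (hcubedepth v (cube_mono z hr hv)).1.le
      · intro e he hw
        exact absurd (cube_mono z hr hw) (hQT e he)
    rcases hclear j z U hopt hcut with h | h
    · exact Or.inl fun v hv => h v (hball v hv)
    · exact Or.inr fun v hv => h v (hball v hv)
  have hfin := signedDiff_le_of_locally_trivial hconn hκ hM hM' hbdry hTdeep hedge hmem
    (show 0 < c₁ / (4 * C) by positivity) (fun x => by
      obtain ⟨z, hz⟩ := exists_norm_pos_sub_le hC ((n : ℝ) • x)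
      refine ⟨Sum.inl z, ?_⟩
      have : Λ.scaledPos n (Sum.inl z) - x = (n : ℝ)⁻¹ • (Λ.pos (Sum.inl z) - (n : ℝ) • x) := by
        rw [smul_sub, smul_smul, inv_mul_cancel₀ hnR.ne', one_smul]
        rfl
      rw [dist_eq_norm, this, norm_smul, Real.norm_eq_abs, abs_of_nonneg (by positivity),
        inv_mul_lt_iff₀ hnR]
      linarith) hUS hloc hmax
  -- The maximal value of discrepancy minus cost is at most zero, so every cut inequality holds.
  intro U' hU'
  have := hmax U' hU'
  linarith

end DimerLattice

/-! ### The probabilistic conclusion -/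

/-- Subadditivity gives the lower bound, so the sets need not be measurable. -/
theorem tendsto_real_one_of_tendsto_compl {Ω : ℕ → Type*} [∀ N, MeasurableSpace (Ω N)]
    (P : ∀ N, Measure (Ω N)) [∀ N, IsProbabilityMeasure (P N)] (A : ∀ N, Set (Ω N))
    (h : Tendsto (fun N => P N (A N)ᶜ) atTop (𝓝 0)) :
    Tendsto (fun N => (P N).real (A N)) atTop (𝓝 1) := by
  have h1 : Tendsto (fun N => 1 - (P N).real (A N)ᶜ) atTop (𝓝 1) := by
    have h2 := (ENNReal.tendsto_toReal ENNReal.zero_ne_top).comp h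
    rw [ENNReal.toReal_zero] at h2
    have h3 := h2.const_sub 1
    rw [sub_zero] at h3
    exact h3
  refine tendsto_of_tendsto_of_tendsto_of_le_of_le h1 tendsto_const_nhds (fun N => ?_)
    fun N => measureReal_le_one
  have h2 := measureReal_union_le (μ := P N) (A N) (A N)ᶜ
  rw [Set.union_compl_self, probReal_univ] at h2
  show 1 - (P N).real (A N)ᶜ ≤ (P N).real (A N)
  linarith

theorem mainTheorem11 {d D : ℕ} (Λ : DimerLattice d D) (δ : ℝ) (hδ : 0 < δ)
    (R : Set (EuclideanSpace ℝ (Fin d)))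
    (hR_compact : IsCompact R) (hR_domain : closure (interior R) = R)
    (hR_smooth : HasPiecewiseSmoothBoundary R) (hR_conn : IsConnected (frontier R))
    -- the lattice approximations of `R` and of `{x ∈ R : d(x, ∂R) > δ}`
    (Rn Rnδ : ℕ → Finset (LVertex d))
    (hRn : Λ.HausdorffApprox (fun n => (Rn n : Set (LVertex d))) R)
    (hRn_bdry : Λ.HausdorffApprox (fun n => Λ.boundary (Rn n)) (frontier R))
    (hRnδ : Λ.HausdorffApprox (fun n => (Rnδ n : Set (LVertex d)))
      {x | x ∈ R ∧ δ < Metric.infDist x (frontier R)})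
    -- the measures `μ n N` and `ν n N` on dimer covers of `Rn n`
    (μ ν : ℕ → ℕ → Measure (LEdge d D → ℕ))
    [∀ n N, IsProbabilityMeasure (μ n N)] [∀ n N, IsProbabilityMeasure (ν n N)]
    (hμ : ∀ᶠ n in atTop, ∀ᶠ N in atTop, ∀ᵐ M ∂(μ n N), Λ.IsDimerCover (Rn n) N M)
    (hν : ∀ᶠ n in atTop, ∀ᶠ N in atTop, ∀ᵐ M ∂(ν n N), Λ.IsDimerCover (Rn n) N M)
    -- the limiting boundary multiplicities
    (α β : ℕ → LVertex d → ℝ)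
    (hα : ∀ᶠ n in atTop, Λ.BoundaryMultiplicitiesTendTo (Rn n) (μ n) (α n))
    (hβ : ∀ᶠ n in atTop, Λ.BoundaryMultiplicitiesTendTo (Rn n) (ν n) (β n))
    (hαβ : ∃ C : ℝ, ∀ᶠ n : ℕ in atTop, ∀ v ∈ Λ.boundary (Rn n), |α n v - β n v| ≤ C / n)
    -- the limiting flow of `ν n N` as `N → ∞`
    (ω : ℕ → LEdge d D → ℝ)
    (hω : ∀ᶠ n in atTop, Λ.ConcentratesOn (Rn n) (ν n) (ω n))
    (hω_int : ∀ᶠ n in atTop, ∀ v ∈ Λ.interior (Rn n), Λ.vertexSum (Rn n) (ω n) v = 1)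
    (hω_bdry : ∀ᶠ n in atTop, ∀ v ∈ Λ.boundary (Rn n), Λ.vertexSum (Rn n) (ω n) v = β n v)
    (hω_pos : ∃ a : ℝ, 0 < a ∧ ∀ᶠ n in atTop, ∀ e ∈ Λ.edges (Rn n), a < ω n e)
    -- the joint law of the two samples
    (P : ℕ → ℕ → Measure ((LEdge d D → ℕ) × (LEdge d D → ℕ)))
    (hP_fst : ∀ n N, (P n N).map Prod.fst = μ n N)
    (hP_snd : ∀ n N, (P n N).map Prod.snd = ν n N) :
    ∃ p : ℕ → ℝ,
      (∀ᶠ n in atTop, Tendsto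
        (fun N => (P n N).real {x | Λ.Patchable (Rn n) (Rnδ n) N x.1 x.2}) atTop (𝓝 (p n))) ∧
      Tendsto p atTop (𝓝 1) := by
  obtain ⟨C, hαβ⟩ := hαβ
  obtain ⟨a, ha, hω_pos⟩ := hω_pos
  have hd : 1 ≤ d := by
    obtain ⟨j, -⟩ := Λ.v₀_not_vertex
    exact j.pos
  have hprob : ∀ n N, IsProbabilityMeasure (P n N) := by
    intro n N
    refine ⟨?_⟩
    have h1 : (P n N).map Prod.fst Set.univ = 1 := by
      rw [hP_fst]
      exact measure_univ
    rwa [Measure.map_apply measurable_fst MeasurableSet.univ, Set.preimage_univ] at h1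
  have hpatch := DimerLattice.eventually_patchable hδ hR_compact hR_conn
    (volume_frontier_eq_zero hd hR_smooth) hRn hRn_bdry hRnδ (half_pos ha)
    (show 0 ≤ |C| + 2 by positivity)
  -- For every large n the limit in N already equals 1.
  refine ⟨fun _ => 1, ?_, tendsto_const_nhds⟩
  filter_upwards [hμ, hν, hα, hβ, hαβ, hω, hω_pos, hpatch, eventually_gt_atTop 0] with n hμ hν hα
    hβ hαβ hω hω_pos hpatch hn0
  have hnR : (0 : ℝ) < n := by exact_mod_cast hn0
  -- Here n is fixed, so the tolerance may depend on it. The bound 1/n keeps the boundary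
  -- discrepancy within (|C| + 2)/n times N, and a/2 keeps M' ≥ (a/2)N on all edges.
  set ε : ℝ := min (1 / n) (a / 2) with hε
  have hε0 : 0 < ε := lt_min (by positivity) (by positivity)
  have hε1 : ε ≤ 1 / n := min_le_left _ _
  have hε2 : ε ≤ a / 2 := min_le_right _ _
  refine tendsto_real_one_of_tendsto_compl (P n) _ ?_
  have hsum := ((hα ε hε0).add (hβ ε hε0)).add (hω ε hε0)
  rw [add_zero, add_zero] at hsum
  refine tendsto_of_tendsto_of_tendsto_of_le_of_le' tendsto_const_nhds hsum
    (Eventually.of_forall fun _ => zero_le) ?_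
  filter_upwards [hμ, hν, eventually_gt_atTop 0] with N hμN hνN hN0
  have hNR : (0 : ℝ) < N := by exact_mod_cast hN0
  -- Only the marginals matter: a union bound works for any joint law, and this inequality holds for
  -- arbitrary, possibly non-measurable B.
  have hfst : ∀ B, P n N (Prod.fst ⁻¹' B) ≤ μ n N B := fun B => by
    rw [← hP_fst]
    exact Measure.le_map_apply measurable_fst.aemeasurable B
  have hsnd : ∀ B, P n N (Prod.snd ⁻¹' B) ≤ ν n N B := fun B => by
    rw [← hP_snd]
    exact Measure.le_map_apply measurable_snd.aemeasurable B
  set B₁ := {M | ∃ v ∈ Λ.boundary (Rn n),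
    ε ≤ |((Λ.vertexSum (Rn n) M v : ℕ) : ℝ) / N - α n v|} with hB₁
  set B₂ := {M | ∃ v ∈ Λ.boundary (Rn n),
    ε ≤ |((Λ.vertexSum (Rn n) M v : ℕ) : ℝ) / N - β n v|} with hB₂
  set B₃ := {M : LEdge d D → ℕ | ∃ e ∈ Λ.edges (Rn n), ε ≤ |(M e : ℝ) / N - ω n e|} with hB₃
  set B₄ := {M | ¬ Λ.IsDimerCover (Rn n) N M} with hB₄
  have h4 : P n N (Prod.fst ⁻¹' B₄) = 0 := le_antisymm ((hfst B₄).trans hμN.le) (zero_le)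
  have h5 : P n N (Prod.snd ⁻¹' B₄) = 0 := le_antisymm ((hsnd B₄).trans hνN.le) (zero_le)
  have hsub : {x : (LEdge d D → ℕ) × (LEdge d D → ℕ) |
      Λ.Patchable (Rn n) (Rnδ n) N x.1 x.2}ᶜ ⊆
      (((Prod.fst ⁻¹' B₁ ∪ Prod.snd ⁻¹' B₂) ∪ Prod.snd ⁻¹' B₃) ∪ Prod.fst ⁻¹' B₄) ∪
        Prod.snd ⁻¹' B₄ := by
    rintro ⟨M, M'⟩ hx
    by_contra hcon
    simp only [Set.mem_union, Set.mem_preimage, not_or] at hcon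
    obtain ⟨⟨⟨⟨h1, h2⟩, h3⟩, h4⟩, h5⟩ := hcon
    have hM : Λ.IsDimerCover (Rn n) N M := not_not.1 h4
    have hM' : Λ.IsDimerCover (Rn n) N M' := not_not.1 h5
    refine hx (hpatch N hN0 M M' hM hM' ?_ ?_)
    · intro v hv
      have h6 : |((Λ.vertexSum (Rn n) M v : ℕ) : ℝ) / N - α n v| < ε := by
        by_contra! h
        exact h1 ⟨v, hv, h⟩
      have h7 : |((Λ.vertexSum (Rn n) M' v : ℕ) : ℝ) / N - β n v| < ε := by
        by_contra! h
        exact h2 ⟨v, hv, h⟩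
      have h8 := hαβ v hv
      have h9 : C / n ≤ |C| / n := div_le_div_of_nonneg_right (le_abs_self C) hnR.le
      have h10 : |((Λ.vertexSum (Rn n) M v : ℕ) : ℝ) / N -
          ((Λ.vertexSum (Rn n) M' v : ℕ) : ℝ) / N| ≤ (|C| + 2) / n := by
        have h11 : (|C| + 2) / n = |C| / n + 1 / n + 1 / n := by ring
        rw [h11]
        rw [abs_lt] at h6 h7
        rw [abs_le] at h8 ⊢
        constructor <;> linarith
      rw [← sub_div, abs_div, abs_of_pos hNR, div_le_iff₀ hNR] at h10
      exact h10
    · intro e he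
      have h6 : |(M' e : ℝ) / N - ω n e| < ε := by
        by_contra! h
        exact h3 ⟨e, he, h⟩
      have h7 := hω_pos e he
      rw [abs_lt] at h6
      rw [← le_div_iff₀ hNR]
      linarith
  calc P n N {x | Λ.Patchable (Rn n) (Rnδ n) N x.1 x.2}ᶜ
      ≤ (((P n N (Prod.fst ⁻¹' B₁) + P n N (Prod.snd ⁻¹' B₂)) + P n N (Prod.snd ⁻¹' B₃)) +
          P n N (Prod.fst ⁻¹' B₄)) + P n N (Prod.snd ⁻¹' B₄) := by
        refine (measure_mono hsub).trans ?_
        refine (measure_union_le _ _).trans (add_le_add_left ?_ _)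
        refine (measure_union_le _ _).trans (add_le_add_left ?_ _)
        refine (measure_union_le _ _).trans (add_le_add_left ?_ _)
        exact measure_union_le _ _
    _ ≤ (μ n N B₁ + ν n N B₂) + ν n N B₃ := by
        rw [h4, h5, add_zero, add_zero]
        exact add_le_add (add_le_add (hfst _) (hsnd _)) (hsnd _)
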